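/- Let $M$ be a connected compact smooth $3$-manifold without boundary and let $A$ be a first order linear differential operator with smooth coefficients acting on $2$-columns of complex-valued half-densities over $M$. Assume that $A$ is formally self-adjoint, $\int_M w^*Av\,dx=\int_M(Aw)^*v\,dx$ for smooth $v,w$. In local coordinates $x$ write $A=-i\,\sigma^\alpha(x)\,\partial/\partial x^\alpha+A_0(x)$ (summation over repeated indices), so that the principal symbol is $A_1(x,\xi)=\sigma^\alpha(x)\xi_\alpha$, and let $A_{\mathrm{sub}}=A_0+\frac i2(A_1)_{x^\alpha\xi_\alpha}$ be the subprincipal symbol, which is a function of $x$ only. Assume that $A$ is elliptic ($\det A_1(x,\xi)\neq0$ for $\xi\ne0$) and that $\operatorname{tr}A_1=0$. For a first order operator on $m$-columns over an $n$-manifold whose principal symbol has positive eigenvalues $h^{(1)}<\dots<h^{(m^+)}$, with normalised eigenvectors $v^{(j)}(x,\xi)$ chosen smoothly near each point $(x,\xi)$, $\xi\ne0$, the second coefficient (the coefficient of $\lambda^{n-1}$ in the asymptotics of the spectral function $e(\lambda,x,x)$) is the density defined by $$b(x)=-n\sum_{j=1}^{m^+}\ \int_{h^{(j)}(x,\xi)<1}\Bigl([v^{(j)}]^*A_{\mathrm{sub}}v^{(j)}-\tfrac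 i2\{[v^{(j)}]^*,A_1-h^{(j)},v^{(j)}\}+\tfrac i{n-1}h^{(j)}\{[v^{(j)}]^*,v^{(j)}\}\Bigr)(x,\xi)\,\frac{d\xi}{(2\pi)^n},$$ where $\{P,R\}=P_{x^\alpha}R_{\xi_\alpha}-P_{\xi_\alpha}R_{x^\alpha}$ and $\{P,Q,R\}=P_{x^\alpha}QR_{\xi_\alpha}-P_{\xi_\alpha}QR_{x^\alpha}$. For the operator $A$ above ($m=2$, $n=3$) define in local coordinates: the metric $g^{\alpha\beta}$ by $\det A_1(x,\xi)=-g^{\alpha\beta}(x)\xi_\alpha\xi_\beta$, with inverse $g_{\alpha\beta}$; the relative orientation $\mathbf c=-\frac i2\sqrt{\det g_{\alpha\beta}}\,\operatorname{tr}\bigl(\sigma^1\sigma^2\sigma^3\bigr)$; the frame $V_1{}^\alpha=\operatorname{Re}(\sigma^\alpha)_{12}$, $V_2{}^\alpha=-\operatorname{Im}(\sigma^\alpha)_{12}$, $V_3{}^\alpha=(\sigma^\alpha)_{11}$ and the coframe $\mathbf V_{k\beta}=g_{\beta\gamma}V_k{}^\gamma$; the teleparallel connection coefficients $\Gamma^\alpha{}_{\mu\beta}=V_k{}^\alpha\,\partial\mathbf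 V_{k\beta}/\partial x^\mu$, its torsion $T^\alpha{}_{\beta\gamma}=\Gamma^\alpha{}_{\beta\gamma}-\Gamma^\alpha{}_{\gamma\beta}$, and the Hodge-dualised torsion $\overset{*}T{}^\alpha{}_\beta=\frac12T^{\alpha\gamma\delta}\varepsilon_{\gamma\delta\beta}\sqrt{\det g_{\mu\nu}}$ (indices raised with $g$, $\varepsilon_{123}=+1$). Then, at every point of every local coordinate system: $\mathbf c\in\{+1,-1\}$; the principal symbol has exactly one positive eigenvalue for each $\xi\neq0$, and normalised eigenvectors can be chosen smoothly near each point $(x,\xi)$, $\xi\ne0$; and, for every such choice of the eigenvectors, the integrand in the definition of $b(x)$ is integrable and $$b(x)=\frac1{8\pi^2}\Bigl(\bigl(\mathbf c\,\operatorname{tr}\overset{*}T-2\operatorname{tr}A_{\mathrm{sub}}\bigr)\sqrt{\det g_{\alpha\beta}}\Bigr)(x).$$ -/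

import Mathlib

open scoped Manifold ContDiff

noncomputable section

namespace SecondCoeff

/-- Coordinate space `ℝⁿ`, used both for positions `x` and for covectors `ξ`. -/
abbrev Coord (n : ℕ) := EuclideanSpace ℝ (Fin n)

/-- The partial derivative `∂f/∂xᵅ`. -/
def pd {n : ℕ} {F : Type*} [NormedAddCommGroup F] [NormedSpace ℝ F]
    (α : Fin n) (f : Coord n → F) (x : Coord n) : F :=
  fderiv ℝ f x (EuclideanSpace.single α (1 : ℝ))

/-- The partial derivative in the position variable of a function of `(x, ξ)`. -/
def pdx {n : ℕ} {F : Type*} [NormedAddCommGroup F] [NormedSpace ℝ F]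
    (α : Fin n) (f : Coord n → Coord n → F) (x ξ : Coord n) : F :=
  pd α (fun y => f y ξ) x

/-- The partial derivative in the momentum variable of a function of `(x, ξ)`. -/
def pdxi {n : ℕ} {F : Type*} [NormedAddCommGroup F] [NormedSpace ℝ F]
    (α : Fin n) (f : Coord n → Coord n → F) (x ξ : Coord n) : F :=
  pd α (fun η => f x η) ξ

/-! ### Half-densities and differential operators on a manifold -/

/-- Smooth local coordinate systems on `M`. -/
abbrev LocalCoords (n : ℕ) (M : Type*) [TopologicalSpace M] [ChartedSpace (Coord n) M] :=
  {φ : OpenPartialHomeomorph M (Coord n) // φ ∈ IsManifold.maximalAtlas (𝓡 n) ∞ M}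

/-- Smooth `m`-columns of complex half-densities on `M`. Such a column `u` is given by its
coordinate representations `u φ`, one for each local coordinate system `φ`; they are smooth on the
coordinate domain and change by the factor `|det ∂y/∂x|^(1/2)` under a change of coordinates
`x ↦ y`. Outside the coordinate domain the representation is zero by convention. -/
def HalfDensity (n m : ℕ) (M : Type*) [TopologicalSpace M] [ChartedSpace (Coord n) M] :
    Submodule ℂ (LocalCoords n M → Coord n → Fin m → ℂ) where
  carrier := {u |
    (∀ φ, ContDiffOn ℝ ∞ (u φ) φ.1.target) ∧
    (∀ φ, ∀ y ∉ φ.1.target, u φ y = 0) ∧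
    ∀ φ ψ : LocalCoords n M, ∀ y ∈ φ.1.target, φ.1.symm y ∈ ψ.1.source →
      u φ y = ((Real.sqrt |(fderiv ℝ (fun z => ψ.1 (φ.1.symm z)) y).det| : ℝ) : ℂ) •
        u ψ (ψ.1 (φ.1.symm y))}
  zero_mem' := by
    refine ⟨fun φ => contDiffOn_const, fun φ y _ => rfl, fun φ ψ y _ _ => ?_⟩
    simp
  add_mem' := by
    rintro u w ⟨hu1, hu2, hu3⟩ ⟨hw1, hw2, hw3⟩
    refine ⟨fun φ => (hu1 φ).add (hw1 φ), fun φ y hy => ?_, fun φ ψ y hy hs => ?_⟩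
    · simp [hu2 φ y hy, hw2 φ y hy]
    · simp only [Pi.add_apply]
      rw [hu3 φ ψ y hy hs, hw3 φ ψ y hy hs, smul_add]
  smul_mem' := by
    rintro c u ⟨hu1, hu2, hu3⟩
    refine ⟨fun φ => (hu1 φ).const_smul c, fun φ y hy => ?_, fun φ ψ y hy hs => ?_⟩
    · simp [hu2 φ y hy]
    · simp only [Pi.smul_apply]
      rw [hu3 φ ψ y hy hs, smul_comm]

/-- A first order linear differential operator with smooth coefficients acting on `m`-columns of
half-densities over an `n`-manifold. In local coordinates `φ` it has the form
`∑ α, (a₁ φ · α) (-i ∂/∂xᵅ) + a₀ φ`. The coefficients are determined by the operator. -/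
structure DiffOp (n m : ℕ) (M : Type*) [TopologicalSpace M] [ChartedSpace (Coord n) M] where
  toLinearMap : HalfDensity n m M →ₗ[ℂ] HalfDensity n m M
  a₁ : LocalCoords n M → Coord n → Fin n → Matrix (Fin m) (Fin m) ℂ
  a₀ : LocalCoords n M → Coord n → Matrix (Fin m) (Fin m) ℂ
  smooth₁ : ∀ φ α i j, ContDiffOn ℝ ∞ (fun x => a₁ φ x α i j) φ.1.target
  smooth₀ : ∀ φ i j, ContDiffOn ℝ ∞ (fun x => a₀ φ x i j) φ.1.target
  apply_eq : ∀ (u : HalfDensity n m M) (φ : LocalCoords n M), ∀ x ∈ φ.1.target,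
    (toLinearMap u).1 φ x =
      ∑ α, (a₁ φ x α).mulVec ((-Complex.I) • pd α (u.1 φ) x) + (a₀ φ x).mulVec (u.1 φ x)

/-- The matrix-function `∑ α, σᵅ(x) ξ_α`, linear in `ξ`. -/
def linSymbol {n m : ℕ} (σ : Coord n → Fin n → Matrix (Fin m) (Fin m) ℂ) (x ξ : Coord n) :
    Matrix (Fin m) (Fin m) ℂ :=
  ∑ α, ((ξ α : ℝ) : ℂ) • σ x α

namespace DiffOp

variable {n m : ℕ} {M : Type*} [TopologicalSpace M] [ChartedSpace (Coord n) M]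

/-- The component `A₁(x, ξ)` of degree one of the full symbol: the principal symbol. -/
def principal (A : DiffOp n m M) (φ : LocalCoords n M) :
    Coord n → Coord n → Matrix (Fin m) (Fin m) ℂ :=
  linSymbol (A.a₁ φ)

/-- The component `A₀(x, ξ)` of degree zero of the full symbol. -/
def degreeZero (A : DiffOp n m M) (φ : LocalCoords n M) :
    Coord n → Coord n → Matrix (Fin m) (Fin m) ℂ :=
  fun x _ => A.a₀ φ x

/-- Formal self-adjointness `∫_M w* (A u) dx = ∫_M (A w)* u dx` for smooth columns `u`, `w` of
half-densities. It is tested on `w` with compact support in a coordinate domain, where the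
integrals over `M` are integrals in the coordinates; a partition of unity gives all `w`. -/
def IsSymmetric (A : DiffOp n m M) : Prop :=
  ∀ (φ : LocalCoords n M) (u w : HalfDensity n m M),
    HasCompactSupport (w.1 φ) → tsupport (w.1 φ) ⊆ φ.1.target →
    ∫ x, dotProduct (star (w.1 φ x)) ((A.toLinearMap u).1 φ x) =
      ∫ x, dotProduct (star ((A.toLinearMap w).1 φ x)) (u.1 φ x)

/-- Ellipticity: the eigenvalues of `A₁(x, ξ)` are nonzero for `ξ ≠ 0`. -/
def IsElliptic (A : DiffOp n m M) : Prop :=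
  ∀ φ : LocalCoords n M, ∀ x ∈ φ.1.target, ∀ ξ : Coord n, ξ ≠ 0 → (A.principal φ x ξ).det ≠ 0

/-- The principal symbol is trace-free. -/
def IsTraceFree (A : DiffOp n m M) : Prop :=
  ∀ φ : LocalCoords n M, ∀ x ∈ φ.1.target, ∀ ξ : Coord n, (A.principal φ x ξ).trace = 0

end DiffOp

/-! ### The second coefficient, for arbitrary `m` and `n` -/

/-- The subprincipal symbol `A_sub = A₀ + (i/2) ∑ α, ∂²A₁/∂xᵅ∂ξ_α`. -/
def subprincipal {n m : ℕ} (A₁ A₀ : Coord n → Coord n → Matrix (Fin m) (Fin m) ℂ)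
    (x ξ : Coord n) : Matrix (Fin m) (Fin m) ℂ :=
  fun i j => A₀ x ξ i j +
    (Complex.I / 2) * ∑ α, pdx α (pdxi α (fun y η => A₁ y η i j)) x ξ

/-- The Poisson bracket `{p*, r} = ∑ α, (p*)_{xᵅ} r_{ξ_α} - (p*)_{ξ_α} r_{xᵅ}` for columns `p`, `r`. -/
def poisson {n m : ℕ} (p r : Coord n → Coord n → Fin m → ℂ) (x ξ : Coord n) : ℂ :=
  ∑ α, (dotProduct (pdx α (fun y η => star (p y η)) x ξ) (pdxi α r x ξ) -
    dotProduct (pdxi α (fun y η => star (p y η)) x ξ) (pdx α r x ξ))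

/-- The generalised bracket `{p*, Q, r} = ∑ α, (p*)_{xᵅ} Q r_{ξ_α} - (p*)_{ξ_α} Q r_{xᵅ}`. -/
def poisson₃ {n m : ℕ} (p : Coord n → Coord n → Fin m → ℂ) (Q : Matrix (Fin m) (Fin m) ℂ)
    (r : Coord n → Coord n → Fin m → ℂ) (x ξ : Coord n) : ℂ :=
  ∑ α, (dotProduct (pdx α (fun y η => star (p y η)) x ξ) (Q.mulVec (pdxi α r x ξ)) -
    dotProduct (pdxi α (fun y η => star (p y η)) x ξ) (Q.mulVec (pdx α r x ξ)))

/-- The positive eigenvalues `h⁽¹⁾ < ... < h⁽ᵏ⁾` of the principal symbol over `U`, together with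
normalised eigenvectors. A smooth normalised eigenvector need not exist globally in `ξ ≠ 0`
(only locally), so a local smooth choice `v j x ξ`, defined near `(x, ξ)`, is recorded for each
point `(x, ξ)`. -/
structure PositiveEigensystem {n m : ℕ} (U : Set (Coord n))
    (A₁ : Coord n → Coord n → Matrix (Fin m) (Fin m) ℂ) (k : ℕ) where
  h : Fin k → Coord n → Coord n → ℝ
  strictMono : ∀ x ∈ U, ∀ ξ : Coord n, ξ ≠ 0 → StrictMono (fun j => h j x ξ)
  isPositiveEigenvalue_iff : ∀ x ∈ U, ∀ ξ : Coord n, ξ ≠ 0 → ∀ r : ℝ,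
    (∃ j, h j x ξ = r) ↔ 0 < r ∧ ∃ w : Fin m → ℂ, w ≠ 0 ∧ (A₁ x ξ).mulVec w = (r : ℂ) • w
  v : Fin k → Coord n → Coord n → (Coord n → Coord n → Fin m → ℂ)
  smooth : ∀ j, ∀ x ∈ U, ∀ ξ : Coord n, ξ ≠ 0 →
    ContDiffAt ℝ ∞ (fun q : Coord n × Coord n => v j x ξ q.1 q.2) (x, ξ)
  eigenvector : ∀ j, ∀ x ∈ U, ∀ ξ : Coord n, ξ ≠ 0 → ∀ᶠ q in nhds (x, ξ),
    (A₁ q.1 q.2).mulVec (v j x ξ q.1 q.2) = ((h j q.1 q.2 : ℝ) : ℂ) • v j x ξ q.1 q.2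
  normalised : ∀ j, ∀ x ∈ U, ∀ ξ : Coord n, ξ ≠ 0 → ∀ᶠ q in nhds (x, ξ),
    dotProduct (star (v j x ξ q.1 q.2)) (v j x ξ q.1 q.2) = 1

namespace PositiveEigensystem

variable {n m k : ℕ} {U : Set (Coord n)} {A₁ : Coord n → Coord n → Matrix (Fin m) (Fin m) ℂ}

/-- The set `h⁽ʲ⁾(x, ξ) < 1` in the punctured cotangent fibre over `x`. -/
def region (S : PositiveEigensystem U A₁ k) (j : Fin k) (x : Coord n) : Set (Coord n) :=
  {ξ | ξ ≠ 0 ∧ S.h j x ξ < 1}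

/-- `v* A_sub v - (i/2) {v*, A₁ - h, v} + (i/(n-1)) h {v*, v}` with `v = v⁽ʲ⁾`, `h = h⁽ʲ⁾`. -/
def integrand (S : PositiveEigensystem U A₁ k)
    (A₀ : Coord n → Coord n → Matrix (Fin m) (Fin m) ℂ) (j : Fin k) (x ξ : Coord n) : ℂ :=
  dotProduct (star (S.v j x ξ x ξ)) ((subprincipal A₁ A₀ x ξ).mulVec (S.v j x ξ x ξ)) -
    (Complex.I / 2) *
      poisson₃ (S.v j x ξ) (A₁ x ξ - ((S.h j x ξ : ℝ) : ℂ) • (1 : Matrix (Fin m) (Fin m) ℂ))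
        (S.v j x ξ) x ξ +
    (Complex.I / ((n : ℂ) - 1)) * ((S.h j x ξ : ℝ) : ℂ) * poisson (S.v j x ξ) (S.v j x ξ) x ξ

/-- The second coefficient
`b(x) = -n ∑ j, ∫_{h⁽ʲ⁾(x,ξ)<1} (v* A_sub v - (i/2) {v*, A₁ - h, v} + (i/(n-1)) h {v*, v}) đξ`,
where `đξ = (2π)⁻ⁿ dξ`. -/
def b (S : PositiveEigensystem U A₁ k)
    (A₀ : Coord n → Coord n → Matrix (Fin m) (Fin m) ℂ) (x : Coord n) : ℂ :=
  -(n : ℂ) * ∑ j, ((2 * (Real.pi : ℂ)) ^ n)⁻¹ * ∫ ξ in S.region j x, S.integrand A₀ j x ξ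

end PositiveEigensystem

/-! ### Geometry of a trace-free `2 × 2` principal symbol `∑ α, σᵅ(x) ξ_α` in dimension three -/

section Geometry

variable (σ : Coord 3 → Fin 3 → Matrix (Fin 2) (Fin 2) ℂ)

/-- The contravariant metric `gᵅᵝ(x)`: the polarisation of the quadratic form
`ξ ↦ -det A₁(x, ξ)`, so that `det A₁(x, ξ) = -gᵅᵝ ξ_α ξ_β`. -/
def gUp (x : Coord 3) : Matrix (Fin 3) (Fin 3) ℝ := fun α β =>
  -(1 / 2 : ℝ) *
    ((linSymbol σ x (EuclideanSpace.single α (1 : ℝ) + EuclideanSpace.single β (1 : ℝ))).det.re -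
      (linSymbol σ x (EuclideanSpace.single α (1 : ℝ))).det.re -
      (linSymbol σ x (EuclideanSpace.single β (1 : ℝ))).det.re)

/-- The covariant metric `g_{αβ}(x)`. -/
def gDown (x : Coord 3) : Matrix (Fin 3) (Fin 3) ℝ := (gUp σ x)⁻¹

/-- The Riemannian density `√(det g_{αβ})`. -/
def sqrtDet (x : Coord 3) : ℝ := Real.sqrt (gDown σ x).det

/-- The relative orientation `c = -(i/2) √(det g_{αβ}) tr((A₁)_{ξ₁} (A₁)_{ξ₂} (A₁)_{ξ₃})`. -/
def orientation (x : Coord 3) : ℂ :=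
  -(Complex.I / 2) * (sqrtDet σ x : ℂ) * (σ x 0 * σ x 1 * σ x 2).trace

/-- The frame `V_jᵅ`: `V₁ᵅ = Re (σᵅ)₁₂`, `V₂ᵅ = -Im (σᵅ)₁₂`, `V₃ᵅ = (σᵅ)₁₁`. -/
def frame (x : Coord 3) (j α : Fin 3) : ℝ :=
  ![(σ x α 0 1).re, -(σ x α 0 1).im, (σ x α 0 0).re] j

/-- The coframe `𝐕_{kβ} = g_{βγ} V_kᵞ`. -/
def coframe (x : Coord 3) (k β : Fin 3) : ℝ := ∑ γ, gDown σ x β γ * frame σ x k γ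

/-- The teleparallel connection coefficients `Γᵅ_{μβ} = V_kᵅ ∂𝐕_{kβ}/∂xᵘ`: those of the
connection for which the frame is parallel. -/
def Gam (x : Coord 3) (α μ β : Fin 3) : ℝ :=
  ∑ k, frame σ x k α * pd μ (fun y => coframe σ y k β) x

/-- The torsion `Tᵅ_{βγ} = Γᵅ_{βγ} - Γᵅ_{γβ}`. -/
def torsion (x : Coord 3) (α β γ : Fin 3) : ℝ := Gam σ x α β γ - Gam σ x α γ β

/-- The torsion with its last two indices raised, `Tᵅᵞᵟ`. -/
def torsionUp (x : Coord 3) (α γ δ : Fin 3) : ℝ :=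
  ∑ μ, ∑ ν, gUp σ x γ μ * gUp σ x δ ν * torsion σ x α μ ν

/-- The totally antisymmetric symbol with `ε₁₂₃ = 1`. -/
def eps (α β γ : Fin 3) : ℝ :=
  (Matrix.of (fun i j : Fin 3 => if ![α, β, γ] i = j then (1 : ℝ) else 0)).det

/-- The Hodge-dualised torsion `*Tᵅ_β = (1/2) Tᵅᵞᵟ ε_{γδβ} √(det g)`. -/
def starTorsion (x : Coord 3) : Matrix (Fin 3) (Fin 3) ℝ := fun α β =>
  (1 / 2 : ℝ) * (∑ γ, ∑ δ, torsionUp σ x α γ δ * eps γ δ β) * sqrtDet σ x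

end Geometry

end SecondCoeff

end

noncomputable section

namespace SecondCoeff

open Set Filter Topology MeasureTheory

/-! The integrand of b(x) is computed exactly at each covector in terms of the frame, and then
averaged over directions.

Formal self-adjointness forces the coefficients σᵅ to be Hermitian: the commutator of A with
multiplication by the coordinate xᵅ is -iσᵅ, so comparing the symmetry identity for xᵅu, w and for
u, xᵅw tests σᵅ - (σᵅ)* against squares of bump functions (`DiffOp.IsSymmetric.isHermitian`).
Together with trace-freeness this gives A₁(x, ξ) = p·s, where s is the triple of Pauli matrices and
p_k = V_kᵅξ_α. Hence det A₁ = -|p|², the only positive eigenvalue is |p|, ellipticity makes the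
frame V invertible, √det g = 1/|det V|, and c is the sign of det V.

A smooth normalised eigenvector v is unique only up to a phase, but the projection P = vv* = (1 +
p·s/|p|)/2 is explicit. The brackets depend only on P: differentiating v*v = 1 shows that {v*, v} is
the sum over α of tr(P[∂P/∂xᵅ, ∂P/∂ξ_α]), which is a triple product in p (`bracket_eq`), while A₁ -
|p| = -2|p|(1 - P) reduces the threefold bracket to -2|p|{v*, v} (`bracket₃_eq`). For n = 3 the two
bracket terms add up to (3i/2)|p|{v*, v}. Thus the integrand is a polynomial of degree two in p/|p|:
a constant ½ tr A_sub, a linear part, and a quadratic part with matrix -¾ times `quadCoeff`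
(`PositiveEigensystem.integrand_eq_angularFun`).

The substitution ξ ↦ p has Jacobian factor √det g and carries the region to the punctured unit ball.
There the linear part integrates to zero and the quadratic part contributes 4π/9 times its trace
(`integral_angularFun`). The trace of `quadCoeff` is the axial contraction ε_{mnl}V_mᵘV_nᵛ∂_μ𝐕_{lν}
(`trace_quadCoeff`), and tr *T is c times the same number (`IsDiracAt.trace_starTorsion`). Since c²
= 1, multiplying by -3/(2π)³ gives the formula. -/

/-! ### Half-densities with compact support in a coordinate domain -/

/-- The determinant is a smooth function on the space of endomorphisms of `ℝⁿ`. -/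
theorem contDiff_clm_det {n : ℕ} : ContDiff ℝ ∞ (fun f : Coord n →L[ℝ] Coord n => f.det) := by
  have h : (fun f : Coord n →L[ℝ] Coord n => f.det) = fun f =>
      (Matrix.of fun i j => f (EuclideanSpace.single j (1 : ℝ)) i).det := by
    funext f
    rw [ContinuousLinearMap.det,
      ← LinearMap.det_toMatrix (EuclideanSpace.basisFun (Fin n) ℝ).toBasis]
    congr 1
  rw [h]
  simp only [Matrix.det_apply, Matrix.of_apply]
  refine ContDiff.sum fun s _ => ContDiff.const_smul _ (contDiff_prod fun i _ => ?_)
  exact ((EuclideanSpace.proj (𝕜 := ℝ) (s i)).contDiff).comp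
    (ContinuousLinearMap.apply ℝ (Coord n) (EuclideanSpace.single i (1 : ℝ))).contDiff

section Extension

variable {n m : ℕ} {M : Type*} [TopologicalSpace M] [ChartedSpace (Coord n) M]

/-- The transition map `ψ ↦ φ` between two coordinate systems. -/
def transition (φ ψ : LocalCoords n M) (z : Coord n) : Coord n := φ.1 (ψ.1.symm z)

/-- The absolute value of the Jacobian of the transition map. -/
def absJac (φ ψ : LocalCoords n M) (z : Coord n) : ℝ := |(fderiv ℝ (transition φ ψ) z).det|

theorem transition_contDiffAt [IsManifold (𝓡 n) ∞ M] (φ ψ : LocalCoords n M) {y : Coord n}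
    (hy : y ∈ ψ.1.target) (hs : ψ.1.symm y ∈ φ.1.source) :
    ContDiffAt ℝ ∞ (transition φ ψ) y := by
  have h := (contDiffGroupoid ∞ (𝓡 n)).compatible_of_mem_maximalAtlas ψ.2 φ.2
  rw [contDiffGroupoid, mem_groupoid_of_pregroupoid] at h
  have h1 : ContDiffOn ℝ ∞ (transition φ ψ) (ψ.1.symm ≫ₕ φ.1).source := by
    have h2 := h.1
    simp [contDiffPregroupoid] at h2
    rw [OpenPartialHomeomorph.trans_source]
    exact h2
  exact h1.contDiffAt ((ψ.1.symm ≫ₕ φ.1).open_source.mem_nhds (by simp [hy, hs]))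

theorem eventually_mem_overlap (φ ψ : LocalCoords n M) {y : Coord n}
    (hy : y ∈ ψ.1.target) (hs : ψ.1.symm y ∈ φ.1.source) :
    ∀ᶠ z in 𝓝 y, z ∈ ψ.1.target ∧ ψ.1.symm z ∈ φ.1.source :=
  (ψ.1.open_target.mem_nhds hy |> Filter.Eventually.and) <|
    (ψ.1.continuousAt_symm hy).eventually (φ.1.open_source.mem_nhds hs)

theorem fderiv_transition_comp [IsManifold (𝓡 n) ∞ M] (φ ψ χ : LocalCoords n M) {y : Coord n}
    (hy : y ∈ ψ.1.target) (hs : ψ.1.symm y ∈ φ.1.source) (hc : ψ.1.symm y ∈ χ.1.source) :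
    fderiv ℝ (transition χ ψ) y =
      (fderiv ℝ (transition χ φ) (transition φ ψ y)).comp (fderiv ℝ (transition φ ψ) y) := by
  have h1 : transition χ ψ =ᶠ[𝓝 y] transition χ φ ∘ transition φ ψ := by
    filter_upwards [eventually_mem_overlap φ ψ hy hs] with z hz
    simp [transition, φ.1.left_inv hz.2]
  rw [h1.fderiv_eq]
  refine fderiv_comp _ ?_ ((transition_contDiffAt φ ψ hy hs).differentiableAt (by simp))
  refine (transition_contDiffAt χ φ (φ.1.map_source hs) ?_).differentiableAt (by simp)
  simpa [transition, φ.1.left_inv hs] using hc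

/-- The cocycle property, which makes the extension by √|det| consistent between all pairs of
coordinate systems. -/
theorem absJac_mul [IsManifold (𝓡 n) ∞ M] (φ ψ χ : LocalCoords n M) {y : Coord n}
    (hy : y ∈ ψ.1.target) (hs : ψ.1.symm y ∈ φ.1.source) (hc : ψ.1.symm y ∈ χ.1.source) :
    absJac χ ψ y = absJac χ φ (transition φ ψ y) * absJac φ ψ y := by
  rw [absJac, fderiv_transition_comp φ ψ χ hy hs hc, absJac, absJac, ← abs_mul]
  congr 1
  exact LinearMap.det_comp _ _

theorem absJac_self (φ : LocalCoords n M) {y : Coord n} (hy : y ∈ φ.1.target) :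
    absJac φ φ y = 1 := by
  have h1 : transition φ φ =ᶠ[𝓝 y] id := by
    filter_upwards [φ.1.open_target.mem_nhds hy] with z hz
    simp [transition, φ.1.right_inv hz]
  rw [absJac, h1.fderiv_eq, fderiv_id]
  simp [ContinuousLinearMap.det]

/-- The transitions ψ → φ → ψ compose to the identity near y, so the Jacobian is a factor of 1.
Positivity is what makes its square root smooth. -/
theorem absJac_pos [IsManifold (𝓡 n) ∞ M] (φ ψ : LocalCoords n M) {y : Coord n}
    (hy : y ∈ ψ.1.target) (hs : ψ.1.symm y ∈ φ.1.source) : 0 < absJac φ ψ y := by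
  have h := absJac_mul φ ψ ψ hy hs (ψ.1.map_target hy)
  rw [absJac_self ψ hy] at h
  refine lt_of_le_of_ne (abs_nonneg _) fun h0 => ?_
  rw [← h0, mul_zero] at h
  exact one_ne_zero h

open Classical in
/-- The coordinate representations of the half-density which equals `f` in the coordinates `φ`
and vanishes outside the domain of `φ`. -/
def extendFun (φ : LocalCoords n M) (f : Coord n → Fin m → ℂ) (ψ : LocalCoords n M)
    (y : Coord n) : Fin m → ℂ :=
  if y ∈ ψ.1.target ∧ ψ.1.symm y ∈ φ.1.source then
    ((Real.sqrt (absJac φ ψ y) : ℝ) : ℂ) • f (transition φ ψ y) else 0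

/-- Inside the domain of φ this is the transformation law. At a point outside it, the Hausdorff
property makes the compact image of the support of f closed in M, so the extension vanishes on a
whole neighbourhood. -/
theorem extendFun_smooth [IsManifold (𝓡 n) ∞ M] [T2Space M] (φ : LocalCoords n M)
    {f : Coord n → Fin m → ℂ} (hf : ContDiff ℝ ∞ f) (hc : HasCompactSupport f)
    (ht : tsupport f ⊆ φ.1.target) (ψ : LocalCoords n M) :
    ContDiffOn ℝ ∞ (extendFun φ f ψ) ψ.1.target := by
  intro y hy
  refine ContDiffAt.contDiffWithinAt ?_
  have hK : IsClosed (φ.1.symm '' tsupport f) :=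
    (hc.isCompact.image_of_continuousOn (φ.1.continuousOn_symm.mono ht)).isClosed
  by_cases hs : ψ.1.symm y ∈ φ.1.source
  · have h1 : extendFun φ f ψ =ᶠ[𝓝 y]
        fun z => Real.sqrt (absJac φ ψ z) • f (transition φ ψ z) := by
      filter_upwards [eventually_mem_overlap φ ψ hy hs] with z hz
      rw [extendFun, if_pos hz]
      ext i
      simp [Complex.real_smul]
    refine ContDiffAt.congr_of_eventuallyEq ?_ h1
    have hT := transition_contDiffAt φ ψ hy hs
    have hp := absJac_pos φ ψ hy hs
    have hd : ContDiffAt ℝ ∞ (fun z => (fderiv ℝ (transition φ ψ) z).det) y :=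
      contDiff_clm_det.contDiffAt.comp y (hT.fderiv_right (m := ∞) (by simp))
    have hq : ContDiffAt ℝ ∞ (fun z => Real.sqrt (absJac φ ψ z)) y :=
      (hd.abs (abs_pos.1 hp)).sqrt hp.ne'
    exact hq.smul (hf.contDiffAt.comp y hT)
  · have hyK : ψ.1.symm y ∉ φ.1.symm '' tsupport f := by
      rintro ⟨z, hz, h⟩
      exact hs (h ▸ φ.1.map_target (ht hz))
    have h1 : extendFun φ f ψ =ᶠ[𝓝 y] fun _ => 0 := by
      filter_upwards [(ψ.1.continuousAt_symm hy).eventually (hK.isOpen_compl.mem_nhds hyK)]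
        with z hz
      rw [extendFun]
      split_ifs with h
      · rw [image_eq_zero_of_notMem_tsupport (f := f), smul_zero]
        intro h2
        exact hz ⟨_, h2, φ.1.left_inv h.2⟩
      · rfl
    exact contDiffAt_const.congr_of_eventuallyEq h1

theorem extendFun_self (φ : LocalCoords n M) {f : Coord n → Fin m → ℂ}
    (ht : tsupport f ⊆ φ.1.target) : extendFun φ f φ = f := by
  funext y
  rw [extendFun]
  split_ifs with h
  · rw [absJac_self φ h.1, transition, φ.1.right_inv h.1]
    simp
  · rw [image_eq_zero_of_notMem_tsupport (f := f)]
    exact fun h2 => h ⟨ht h2, φ.1.map_target (ht h2)⟩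

/-- A smooth column compactly supported in a coordinate domain, as a half-density on `M`. -/
theorem exists_halfDensity_eq [IsManifold (𝓡 n) ∞ M] [T2Space M] (φ : LocalCoords n M)
    {f : Coord n → Fin m → ℂ} (hf : ContDiff ℝ ∞ f) (hc : HasCompactSupport f)
    (ht : tsupport f ⊆ φ.1.target) : ∃ u : HalfDensity n m M, u.1 φ = f := by
  refine ⟨⟨extendFun φ f, extendFun_smooth φ hf hc ht, ?_, ?_⟩, extendFun_self φ ht⟩
  · intro ψ y hy
    rw [extendFun, if_neg (fun h => hy h.1)]
  · intro ψ χ y hy hs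
    change _ = ((Real.sqrt (absJac χ ψ y) : ℝ) : ℂ) • extendFun φ f χ (transition χ ψ y)
    have hinv : χ.1.symm (transition χ ψ y) = ψ.1.symm y := χ.1.left_inv hs
    have ht' : transition χ ψ y ∈ χ.1.target := χ.1.map_source hs
    rw [extendFun, extendFun, hinv]
    by_cases h : ψ.1.symm y ∈ φ.1.source
    · rw [if_pos ⟨hy, h⟩, if_pos ⟨ht', h⟩, absJac_mul χ ψ φ hy hs h,
        
        Real.sqrt_mul (show 0 ≤ absJac φ χ (transition χ ψ y) from abs_nonneg _),
        smul_smul, Complex.ofReal_mul, mul_comm]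
      congr 2
      simp [transition, χ.1.left_inv hs]
    · rw [if_neg (fun h' => h h'.2), if_neg (fun h' => h h'.2), smul_zero]

end Extension

/-! ### A formally self-adjoint operator has a Hermitian principal symbol -/

section Hermitian

variable {n m : ℕ} {M : Type*} [TopologicalSpace M] [ChartedSpace (Coord n) M]

/-- The column whose only nonzero entry is the real function `f`, in position `j`. -/
def realColumn (f : Coord n → ℝ) (j : Fin m) (y : Coord n) : Fin m → ℂ :=
  Pi.single j ((f y : ℝ) : ℂ)

theorem realColumn_eq (f : Coord n → ℝ) (j : Fin m) (y : Coord n) :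
    realColumn f j y = f y • (Pi.single j 1 : Fin m → ℂ) := by
  ext k
  by_cases h : k = j
  · subst h; simp [realColumn, Complex.real_smul]
  · simp [realColumn, h]

theorem realColumn_contDiff {f : Coord n → ℝ} (hf : ContDiff ℝ ∞ f) (j : Fin m) :
    ContDiff ℝ ∞ (realColumn f j) := by
  rw [funext (realColumn_eq f j)]
  exact hf.smul contDiff_const

theorem support_realColumn (f : Coord n → ℝ) (j : Fin m) :
    Function.support (realColumn f j) = Function.support f := by
  ext y
  simp [realColumn]

theorem pd_realColumn {f : Coord n → ℝ} {y : Coord n} (hf : DifferentiableAt ℝ f y) (j : Fin m)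
    (α : Fin n) : pd α (realColumn f j) y = Pi.single j ((pd α f y : ℝ) : ℂ) := by
  rw [pd, funext (realColumn_eq f j), fderiv_smul_const hf]
  exact (realColumn_eq (fun y => pd α f y) j y).symm

theorem exists_realColumn [IsManifold (𝓡 n) ∞ M] [T2Space M] (φ : LocalCoords n M)
    {f : Coord n → ℝ} (hf : ContDiff ℝ ∞ f) (hc : HasCompactSupport f)
    (ht : tsupport f ⊆ φ.1.target) (j : Fin m) :
    ∃ u : HalfDensity n m M, u.1 φ = realColumn f j :=
  exists_halfDensity_eq φ (realColumn_contDiff hf j)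
    (by rwa [HasCompactSupport, tsupport, support_realColumn])
    (by rwa [tsupport, support_realColumn])

theorem dotProduct_star_realColumn (f : Coord n → ℝ) (i : Fin m) (y : Coord n) (z : Fin m → ℂ) :
    dotProduct (star (realColumn f i y)) z = (f y : ℂ) * z i := by
  rw [realColumn, dotProduct, Finset.sum_eq_single i]
  · simp
  · intro b _ hb; simp [hb]
  · simp

theorem dotProduct_realColumn (f : Coord n → ℝ) (i : Fin m) (y : Coord n) (z : Fin m → ℂ) :
    dotProduct (star z) (realColumn f i y) = star (z i) * (f y : ℂ) := by
  rw [realColumn, dotProduct_single]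
  simp

theorem DiffOp.apply_realColumn (A : DiffOp n m M) (φ : LocalCoords n M) {u : HalfDensity n m M}
    {f : Coord n → ℝ} {j : Fin m} (hu : u.1 φ = realColumn f j) {y : Coord n}
    (hy : y ∈ φ.1.target) (hf : DifferentiableAt ℝ f y) (i : Fin m) :
    (A.toLinearMap u).1 φ y i =
      ∑ α, A.a₁ φ y α i j * (-Complex.I * (pd α f y : ℝ)) + A.a₀ φ y i j * (f y : ℝ) := by
  rw [A.apply_eq u φ y hy, hu]
  simp only [pd_realColumn hf, realColumn, Pi.add_apply, Finset.sum_apply, Matrix.mulVec_smul,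
    Matrix.mulVec_single, Pi.smul_apply, smul_eq_mul, MulOpposite.smul_eq_mul_unop,
    MulOpposite.unop_op, Matrix.col_apply]
  congr 1
  refine Finset.sum_congr rfl fun α _ => ?_
  ring

theorem pd_coord_mul {f : Coord n → ℝ} {y : Coord n} (hf : DifferentiableAt ℝ f y)
    (α β : Fin n) :
    pd β (fun z => z α * f z) y = y α * pd β f y + (if α = β then 1 else 0) * f y := by
  have h1 : HasFDerivAt (fun z : Coord n => z α) (EuclideanSpace.proj (𝕜 := ℝ) α) y :=
    (EuclideanSpace.proj (𝕜 := ℝ) α : Coord n →L[ℝ] ℝ).hasFDerivAt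
  have h2 := (h1.mul hf.hasFDerivAt).fderiv
  change fderiv ℝ (fun z : Coord n => z α * f z) y = _ at h2
  rw [pd, h2]
  simp [pd, mul_comm]

/-- The commutator of A with the coordinate xᵅ is the zeroth order operator -iσᵅ; the term A₀
cancels. -/
theorem DiffOp.apply_coord_mul (A : DiffOp n m M) (φ : LocalCoords n M) {u v : HalfDensity n m M}
    {f : Coord n → ℝ} {j : Fin m} (hu : u.1 φ = realColumn f j) (α : Fin n)
    (hv : v.1 φ = realColumn (fun z => z α * f z) j) {y : Coord n}
    (hy : y ∈ φ.1.target) (hf : DifferentiableAt ℝ f y) (i : Fin m) :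
    (A.toLinearMap v).1 φ y i =
      (y α : ℂ) * (A.toLinearMap u).1 φ y i + -Complex.I * (f y : ℂ) * A.a₁ φ y α i j := by
  have hz : DifferentiableAt ℝ (fun z : Coord n => z α) y :=
    (EuclideanSpace.proj (𝕜 := ℝ) α : Coord n →L[ℝ] ℝ).differentiableAt
  rw [A.apply_realColumn φ hv hy (hz.mul hf), A.apply_realColumn φ hu hy hf]
  simp only [pd_coord_mul hf]
  have : ∀ β, A.a₁ φ y β i j * (-Complex.I *
      ((y α * pd β f y + (if α = β then 1 else 0) * f y : ℝ) : ℂ)) =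
      (y α : ℂ) * (A.a₁ φ y β i j * (-Complex.I * (pd β f y : ℝ))) +
      (if α = β then -Complex.I * (f y : ℂ) * A.a₁ φ y β i j else 0) := by
    intro β
    split_ifs <;> push_cast <;> ring
  rw [Finset.sum_congr rfl fun β _ => this β, Finset.sum_add_distrib, ← Finset.mul_sum]
  simp
  ring

theorem continuous_mul_of_tsupport_subset {U : Set (Coord n)} (hU : IsOpen U) {f : Coord n → ℝ}
    (hf : Continuous f) (ht : tsupport f ⊆ U) {g : Coord n → ℂ} (hg : ContinuousOn g U) :
    Continuous fun y => (f y : ℂ) * g y := by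
  refine ContinuousOn.continuous_of_tsupport_subset
    ((Complex.continuous_ofReal.comp hf).continuousOn.mul hg) hU (subset_trans ?_ ht)
  refine closure_mono fun y hy => ?_
  intro h
  simp [h] at hy

theorem integrable_mul_of_tsupport_subset {U : Set (Coord n)} (hU : IsOpen U) {f : Coord n → ℝ}
    (hf : Continuous f) (hc : HasCompactSupport f) (ht : tsupport f ⊆ U) {g : Coord n → ℂ}
    (hg : ContinuousOn g U) : Integrable fun y => (f y : ℂ) * g y := by
  refine (continuous_mul_of_tsupport_subset hU hf ht hg).integrable_of_hasCompactSupport ?_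
  refine hc.mono fun y hy => ?_
  intro h
  simp [h] at hy

theorem HalfDensity.continuousOn_apply (u : HalfDensity n m M) (φ : LocalCoords n M)
    (i : Fin m) : ContinuousOn (fun y => u.1 φ y i) φ.1.target :=
  (continuous_apply i).comp_continuousOn (u.2.1 φ).continuousOn

/-- Symmetry is applied to the pairs (xᵅf e_j, f e_i) and (f e_j, xᵅf e_i) and the results are
subtracted. Only commutators with xᵅ survive, so no integration by parts is needed. -/
theorem DiffOp.IsSymmetric.integral_eq_zero [IsManifold (𝓡 n) ∞ M] [T2Space M] {A : DiffOp n m M}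
    (hA : A.IsSymmetric) (φ : LocalCoords n M) {f : Coord n → ℝ} (hf : ContDiff ℝ ∞ f)
    (hc : HasCompactSupport f) (ht : tsupport f ⊆ φ.1.target) (α : Fin n) (i j : Fin m) :
    ∫ y, (f y : ℂ) * ((f y : ℂ) * (A.a₁ φ y α i j - star (A.a₁ φ y α j i))) = 0 := by
  have hp : ContDiff ℝ ∞ (fun z : Coord n => z α) :=
    (EuclideanSpace.proj (𝕜 := ℝ) α : Coord n →L[ℝ] ℝ).contDiff
  have hg : ContDiff ℝ ∞ (fun z : Coord n => z α * f z) := hp.mul hf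
  have hgc : HasCompactSupport (fun z : Coord n => z α * f z) := hc.mul_left
  have hgt : tsupport (fun z : Coord n => z α * f z) ⊆ φ.1.target :=
    (tsupport_mul_subset_right).trans ht
  obtain ⟨u0, hu0⟩ := exists_realColumn φ hf hc ht j
  obtain ⟨u1, hu1⟩ := exists_realColumn φ hg hgc hgt j
  obtain ⟨w0, hw0⟩ := exists_realColumn φ hf hc ht i
  obtain ⟨w1, hw1⟩ := exists_realColumn φ hg hgc hgt i
  have supp : ∀ (k : Fin m) {h : Coord n → ℝ}, HasCompactSupport h →
      HasCompactSupport (realColumn h k) := fun k h hh => by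
    rwa [HasCompactSupport, tsupport, support_realColumn]
  have tsupp : ∀ (k : Fin m) (h : Coord n → ℝ), tsupport (realColumn h k) = tsupport h :=
    fun k h => by rw [tsupport, support_realColumn, tsupport]
  have e1 := hA φ u1 w0 (hw0 ▸ supp i hc) (by rw [hw0, tsupp]; exact ht)
  have e2 := hA φ u0 w1 (hw1 ▸ supp i hgc) (by rw [hw1, tsupp]; exact hgt)
  rw [hw0, hu1] at e1
  rw [hw1, hu0] at e2
  simp only [dotProduct_star_realColumn, dotProduct_realColumn] at e1 e2
  have ho := φ.1.open_target
  have i1 := integrable_mul_of_tsupport_subset ho hf.continuous hc ht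
    (HalfDensity.continuousOn_apply (A.toLinearMap u1) φ i)
  have i2 := integrable_mul_of_tsupport_subset ho hg.continuous hgc hgt
    (HalfDensity.continuousOn_apply (A.toLinearMap u0) φ i)
  have i3 := integrable_mul_of_tsupport_subset ho hg.continuous hgc hgt
    (continuous_star.comp_continuousOn (HalfDensity.continuousOn_apply (A.toLinearMap w0) φ j))
  have i4 := integrable_mul_of_tsupport_subset ho hf.continuous hc ht
    (continuous_star.comp_continuousOn (HalfDensity.continuousOn_apply (A.toLinearMap w1) φ j))
  simp only [Function.comp_apply, mul_comm _ (star _)] at i3 i4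
  have e3 := congrArg₂ (fun s t => s - t) e1 e2
  beta_reduce at e3
  rw [← integral_sub i1 i2, ← integral_sub i3 i4, ← sub_eq_zero] at e3
  have e5 := integral_sub (i1.sub i2) (i3.sub i4)
  simp only [Pi.sub_apply] at e5
  rw [← e5] at e3
  have e4 : ∫ y, -Complex.I * ((f y : ℂ) * ((f y : ℂ) *
      (A.a₁ φ y α i j - star (A.a₁ φ y α j i)))) = 0 := by
    rw [← e3]
    refine integral_congr_ae (Eventually.of_forall fun y => ?_)
    beta_reduce
    by_cases hy : y ∈ φ.1.target
    · have hfy := hf.differentiable (by simp) y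
      rw [A.apply_coord_mul φ hu0 α hu1 hy hfy, A.apply_coord_mul φ hw0 α hw1 hy hfy]
      simp only [Complex.star_def, map_add, map_mul, map_neg, Complex.conj_I, Complex.conj_ofReal]
      push_cast
      ring
    -- Off the coordinate domain nothing is known about the coefficients, but both sides vanish with
    -- f.
    · have : f y = 0 := image_eq_zero_of_notMem_tsupport fun h => hy (ht h)
      simp [this]
  rw [integral_const_mul] at e4
  simpa using e4

/-- The coefficients of the principal symbol of a formally self-adjoint operator are Hermitian. -/
theorem DiffOp.IsSymmetric.isHermitian [IsManifold (𝓡 n) ∞ M] [T2Space M] {A : DiffOp n m M}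
    (hA : A.IsSymmetric) (φ : LocalCoords n M) {x : Coord n} (hx : x ∈ φ.1.target) (α : Fin n) :
    (A.a₁ φ x α).IsHermitian := by
  refine Matrix.IsHermitian.ext fun i j => ?_
  by_contra hne
  let D : Coord n → ℂ := fun y => A.a₁ φ y α i j - star (A.a₁ φ y α j i)
  have hD : ContinuousOn D φ.1.target := (A.smooth₁ φ α i j).continuousOn.sub
    (continuous_star.comp_continuousOn (A.smooth₁ φ α j i).continuousOn)
  have hDx : D x ≠ 0 := fun h => hne (sub_eq_zero.1 h).symm
  -- Multiplying by the conjugate of D(x) rotates the value at x to |D(x)|² > 0, so the real part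
  -- stays positive near x and a bump function there contradicts the vanishing integral.
  let E : Coord n → ℂ := fun y => star (D x) * D y
  have hE : ContinuousOn E φ.1.target := continuousOn_const.mul hD
  have hEx : 0 < (E x).re := by
    simp only [E, Complex.star_def, ← Complex.normSq_eq_conj_mul_self, Complex.ofReal_re]
    exact Complex.normSq_pos.2 hDx
  have hnear : ∀ᶠ y in 𝓝 x, y ∈ φ.1.target ∧ 0 < (E y).re :=
    (φ.1.open_target.mem_nhds hx |> Filter.Eventually.and) <|
      (Complex.continuous_re.continuousAt.comp (hE.continuousAt (φ.1.open_target.mem_nhds hx))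
        ).eventually (lt_mem_nhds hEx)
  obtain ⟨r, hr, hball⟩ := Metric.nhds_basis_closedBall.eventually_iff.1 hnear
  let f : ContDiffBump x := ⟨r / 2, r, by positivity, by linarith⟩
  have hft : tsupport f ⊆ φ.1.target := by
    rw [f.tsupport_eq]
    exact fun y hy => (hball hy).1
  have key := hA.integral_eq_zero φ f.contDiff f.hasCompactSupport hft α i j
  have key2 : ∫ y, (f y : ℂ) * ((f y : ℂ) * E y) = 0 := by
    have : ∀ y, (f y : ℂ) * ((f y : ℂ) * E y) = star (D x) * ((f y : ℂ) * ((f y : ℂ) * D y)) :=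
      fun y => by simp only [E]; ring
    simp only [this]
    rw [integral_const_mul, key, mul_zero]
  have hcont : Continuous fun y => (f y : ℂ) * ((f y : ℂ) * E y) :=
    continuous_mul_of_tsupport_subset φ.1.open_target f.continuous hft
      ((Complex.continuous_ofReal.comp f.continuous).continuousOn.mul hE)
  have hre : ∀ y, ((f y : ℂ) * ((f y : ℂ) * E y)).re = f y * (f y * (E y).re) := fun y => by
    rw [Complex.re_ofReal_mul, Complex.re_ofReal_mul]
  have hcomp : HasCompactSupport fun y => ((f y : ℂ) * ((f y : ℂ) * E y)).re := by
    refine f.hasCompactSupport.mono fun y hy h => ?_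
    simp [h] at hy
  have hpos := (Complex.continuous_re.comp hcont).integral_pos_of_hasCompactSupport_nonneg_nonzero
    (μ := volume) (x := x) hcomp (fun y => ?_) ?_
  · have hint2 : Integrable fun y => (f y : ℂ) * ((f y : ℂ) * E y) :=
      hcont.integrable_of_hasCompactSupport (f.hasCompactSupport.mono fun y hy h => by
        simp [h] at hy)
    have := integral_re hint2
    rw [key2] at this
    simp only [Function.comp_apply] at hpos
    simp at this
    simp at hpos
    linarith
  · simp only [Function.comp_apply, hre, Pi.zero_apply]
    by_cases hy : y ∈ tsupport f
    · rw [f.tsupport_eq] at hy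
      have := (hball hy).2
      have := f.nonneg' y
      positivity
    · simp [image_eq_zero_of_notMem_tsupport hy]
  · simp only [Function.comp_apply, hre]
    rw [f.one_of_mem_closedBall (Metric.mem_closedBall_self f.rIn_pos.le)]
    simpa using hEx.ne'

end Hermitian

/-! ### Trace-free Hermitian `2 × 2` symbols and their frames -/

/-- The Hermitian trace-free matrix `p₁ s¹ + p₂ s² + p₃ s³`, where `sʲ` are the Pauli matrices. -/
def pauliMat (p : Fin 3 → ℝ) : Matrix (Fin 2) (Fin 2) ℂ :=
  !![(p 2 : ℂ), p 0 - Complex.I * p 1; p 0 + Complex.I * p 1, -(p 2 : ℂ)]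

/-- The squared length `p₁² + p₂² + p₃²`. -/
def sqLen (p : Fin 3 → ℝ) : ℝ := p 0 ^ 2 + p 1 ^ 2 + p 2 ^ 2

theorem sqLen_nonneg (p : Fin 3 → ℝ) : 0 ≤ sqLen p := by unfold sqLen; positivity

theorem sqLen_pos {p : Fin 3 → ℝ} (hp : p ≠ 0) : 0 < sqLen p := by
  refine lt_of_le_of_ne (sqLen_nonneg p) fun h => hp ?_
  unfold sqLen at h
  have h0 : p 0 = 0 := by nlinarith [sq_nonneg (p 0), sq_nonneg (p 1), sq_nonneg (p 2)]
  have h1 : p 1 = 0 := by nlinarith [sq_nonneg (p 0), sq_nonneg (p 1), sq_nonneg (p 2)]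
  have h2 : p 2 = 0 := by nlinarith [sq_nonneg (p 0), sq_nonneg (p 1), sq_nonneg (p 2)]
  funext k
  fin_cases k <;> assumption

theorem det_pauliMat (p : Fin 3 → ℝ) : (pauliMat p).det = -(sqLen p : ℂ) := by
  simp only [pauliMat, Matrix.det_fin_two_of, sqLen]
  push_cast
  linear_combination (p 1 : ℂ) ^ 2 * Complex.I_sq

/-- At the point `x` the symbol `∑ α, σᵅ ξ_α` is Hermitian, trace-free and elliptic. -/
structure IsDiracAt (σ : Coord 3 → Fin 3 → Matrix (Fin 2) (Fin 2) ℂ) (x : Coord 3) : Prop where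
  isHermitian : ∀ α, (σ x α).IsHermitian
  trace_eq_zero : ∀ α, (σ x α).trace = 0
  det_ne_zero : ∀ ξ : Coord 3, ξ ≠ 0 → (linSymbol σ x ξ).det ≠ 0

theorem linSymbol_single {n m : ℕ} (σ : Coord n → Fin n → Matrix (Fin m) (Fin m) ℂ)
    (x : Coord n) (α : Fin n) : linSymbol σ x (EuclideanSpace.single α (1 : ℝ)) = σ x α := by
  rw [linSymbol, Finset.sum_eq_single α]
  · simp
  · intro b _ hb
    simp [hb]
  · simp

/-- The only place where self-adjointness, ellipticity and trace-freeness of the operator enter;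
everything later uses this pointwise condition and smoothness of the coefficients. -/
theorem DiffOp.isDiracAt {M : Type*} [TopologicalSpace M] [ChartedSpace (Coord 3) M]
    [IsManifold (𝓡 3) ∞ M] [T2Space M] {A : DiffOp 3 2 M} (hsym : A.IsSymmetric)
    (hell : A.IsElliptic) (htr : A.IsTraceFree) (φ : LocalCoords 3 M) {x : Coord 3}
    (hx : x ∈ φ.1.target) : IsDiracAt (A.a₁ φ) x where
  isHermitian := hsym.isHermitian φ hx
  trace_eq_zero α := by
    have := htr φ x hx (EuclideanSpace.single α 1)
    rwa [DiffOp.principal, linSymbol_single] at this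
  det_ne_zero := hell φ x hx

section Frame

variable {σ : Coord 3 → Fin 3 → Matrix (Fin 2) (Fin 2) ℂ} {x : Coord 3}

/-- The components `p_k = V_kᵅ ξ_α` of a covector with respect to the frame. -/
def momentum (σ : Coord 3 → Fin 3 → Matrix (Fin 2) (Fin 2) ℂ) (x ξ : Coord 3) (k : Fin 3) : ℝ :=
  ∑ α, frame σ x k α * ξ α

theorem IsDiracAt.eq_pauliMat (h : IsDiracAt σ x) (α : Fin 3) :
    σ x α = pauliMat (fun k => frame σ x k α) := by
  have hh := h.isHermitian α
  have h00 := hh.apply 0 0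
  have h10 := hh.apply 1 0
  have ht := h.trace_eq_zero α
  rw [Matrix.trace_fin_two] at ht
  have e11 : σ x α 1 1 = -σ x α 0 0 := by linear_combination ht
  have e00 : ((σ x α 0 0).re : ℂ) = σ x α 0 0 := Complex.conj_eq_iff_re.1 h00
  ext i j
  fin_cases i <;> fin_cases j
  · simp [pauliMat, frame, e00]
  · apply Complex.ext <;> simp [pauliMat, frame]
  · simp only [Fin.mk_one, Fin.zero_eta, ← h10]
    apply Complex.ext <;> simp [pauliMat, frame]
  · simp [pauliMat, frame, e00, e11]

theorem IsDiracAt.linSymbol_eq (h : IsDiracAt σ x) (ξ : Coord 3) :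
    linSymbol σ x ξ = pauliMat (momentum σ x ξ) := by
  rw [linSymbol, Finset.sum_congr rfl fun α _ => by rw [h.eq_pauliMat α]]
  ext i j
  fin_cases i <;> fin_cases j <;>
    simp [Fin.sum_univ_three, pauliMat, momentum] <;> ring

theorem IsDiracAt.momentum_ne_zero (h : IsDiracAt σ x) {ξ : Coord 3} (hξ : ξ ≠ 0) :
    momentum σ x ξ ≠ 0 := by
  intro h0
  have := h.det_ne_zero ξ hξ
  rw [h.linSymbol_eq, h0] at this
  simp [det_pauliMat, sqLen] at this

/-- The matrix of the frame. -/
abbrev frameMat (σ : Coord 3 → Fin 3 → Matrix (Fin 2) (Fin 2) ℂ) (x : Coord 3) :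
    Matrix (Fin 3) (Fin 3) ℝ := Matrix.of (frame σ x)

/-- A nonzero covector annihilated by the frame would have p = 0, hence A₁ = 0, against ellipticity.
-/
theorem IsDiracAt.det_frameMat_ne_zero (h : IsDiracAt σ x) : (frameMat σ x).det ≠ 0 := by
  intro h0
  obtain ⟨v, hv, hv0⟩ := Matrix.exists_mulVec_eq_zero_iff.2 h0
  refine h.momentum_ne_zero (ξ := WithLp.toLp 2 v) (fun h1 => hv ?_) ?_
  · simpa using h1
  · funext k
    simpa [momentum, Matrix.mulVec, dotProduct] using congrFun hv0 k

/-- Polarisation of -det A₁ = |p|²: the frame is orthonormal for g. -/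
theorem IsDiracAt.gUp_eq (h : IsDiracAt σ x) :
    gUp σ x = (frameMat σ x).transpose * frameMat σ x := by
  ext α β
  have hd : ∀ ξ, (linSymbol σ x ξ).det.re = -sqLen (momentum σ x ξ) := fun ξ => by
    rw [h.linSymbol_eq, det_pauliMat]
    simp
  have hs : ∀ γ k, momentum σ x (EuclideanSpace.single γ 1) k = frame σ x k γ := fun γ k => by
    simp [momentum]
  have ha : ∀ k, momentum σ x (EuclideanSpace.single α 1 + EuclideanSpace.single β 1) k =
      frame σ x k α + frame σ x k β := fun k => by
    simp [momentum, mul_add, Finset.sum_add_distrib]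
  rw [gUp, hd, hd, hd]
  simp only [sqLen, hs, ha, Matrix.mul_apply, Fin.sum_univ_three, Matrix.transpose_apply,
    Matrix.of_apply]
  ring

theorem IsDiracAt.sqrtDet_eq (h : IsDiracAt σ x) : sqrtDet σ x = |(frameMat σ x).det|⁻¹ := by
  rw [sqrtDet, gDown, h.gUp_eq, Matrix.det_nonsing_inv, Matrix.det_mul, Matrix.det_transpose,
    Ring.inverse_eq_inv', ← pow_two, Real.sqrt_inv, Real.sqrt_sq_eq_abs]

/-- As tr(sʲsᵏsˡ) = 2iε_{jkl}, the trace of σ¹σ²σ³ is 2i det V. Since √det g = 1/|det V|, the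
relative orientation is the sign of det V. -/
theorem IsDiracAt.orientation_eq (h : IsDiracAt σ x) :
    orientation σ x = ((sqrtDet σ x * (frameMat σ x).det : ℝ) : ℂ) := by
  have ht : (σ x 0 * σ x 1 * σ x 2).trace = 2 * Complex.I * ((frameMat σ x).det : ℂ) := by
    rw [h.eq_pauliMat 0, h.eq_pauliMat 1, h.eq_pauliMat 2, Matrix.det_fin_three]
    simp only [pauliMat, Matrix.trace_fin_two, Matrix.mul_apply, Fin.sum_univ_two, Matrix.of_apply]
    simp
    generalize frame σ x = V
    ring_nf
  rw [orientation, ht]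
  push_cast
  linear_combination -(sqrtDet σ x : ℂ) * ((frameMat σ x).det : ℂ) * Complex.I_sq

theorem IsDiracAt.sqrtDet_mul_det_sq (h : IsDiracAt σ x) :
    (sqrtDet σ x * (frameMat σ x).det) ^ 2 = 1 := by
  have := abs_pos.2 h.det_frameMat_ne_zero
  rw [h.sqrtDet_eq, mul_pow, ← sq_abs (frameMat σ x).det]
  field_simp

theorem IsDiracAt.orientation_eq_or (h : IsDiracAt σ x) :
    orientation σ x = 1 ∨ orientation σ x = -1 := by
  rw [h.orientation_eq]
  rcases sq_eq_one_iff.1 h.sqrtDet_mul_det_sq with h1 | h1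
  · left; rw [h1]; simp
  · right; rw [h1]; simp

/-- Lowering an index with g⁻¹ = (VᵀV)⁻¹ cancels Vᵀ and leaves V⁻¹, so the coframe is the dual
basis. -/
theorem IsDiracAt.coframe_eq (h : IsDiracAt σ x) (k β : Fin 3) :
    coframe σ x k β = (frameMat σ x)⁻¹ β k := by
  have hu : IsUnit (frameMat σ x).transpose.det := by
    rw [Matrix.det_transpose]; exact isUnit_iff_ne_zero.2 h.det_frameMat_ne_zero
  have : (gDown σ x * (frameMat σ x).transpose) β k = (frameMat σ x)⁻¹ β k := by
    rw [gDown, h.gUp_eq, Matrix.mul_inv_rev, Matrix.nonsing_inv_mul_cancel_right _ _ hu]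
  rw [← this, Matrix.mul_apply]
  rfl

theorem IsDiracAt.sum_coframe_mul_frame (h : IsDiracAt σ x) (k l : Fin 3) :
    ∑ β, coframe σ x k β * frame σ x l β = if l = k then 1 else 0 := by
  have h1 := Matrix.mul_nonsing_inv (frameMat σ x) (isUnit_iff_ne_zero.2 h.det_frameMat_ne_zero)
  have h2 := congrFun (congrFun h1 l) k
  rw [Matrix.mul_apply, Matrix.one_apply] at h2
  rw [← h2]
  exact Finset.sum_congr rfl fun β _ => by rw [h.coframe_eq, mul_comm]; rfl

theorem IsDiracAt.sum_coframe_mul_momentum (h : IsDiracAt σ x) (ξ : Coord 3) (β : Fin 3) :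
    ∑ k, coframe σ x k β * momentum σ x ξ k = ξ β := by
  have h1 := Matrix.nonsing_inv_mul (frameMat σ x) (isUnit_iff_ne_zero.2 h.det_frameMat_ne_zero)
  have h2 := congrFun (congrArg (fun B => Matrix.mulVec B ξ.ofLp) h1) β
  simp only [← Matrix.mulVec_mulVec, Matrix.one_mulVec] at h2
  rw [← h2]
  simp only [h.coframe_eq]
  rfl

theorem differentiableAt_matrix_det {n : ℕ} {E : Type*} [NormedAddCommGroup E] [NormedSpace ℝ E]
    {B : E → Matrix (Fin n) (Fin n) ℝ} {x : E} (hB : ∀ i j, DifferentiableAt ℝ (fun y => B y i j) x) :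
    DifferentiableAt ℝ (fun y => (B y).det) x := by
  simp only [Matrix.det_apply]
  refine DifferentiableAt.fun_sum fun s _ => DifferentiableAt.const_smul ?_ _
  exact (HasFDerivAt.finsetProd fun i _ => (hB (s i) i).hasFDerivAt).differentiableAt

theorem differentiableAt_matrix_inv {n : ℕ} {E : Type*} [NormedAddCommGroup E] [NormedSpace ℝ E]
    {B : E → Matrix (Fin n) (Fin n) ℝ} {x : E} (hB : ∀ i j, DifferentiableAt ℝ (fun y => B y i j) x)
    (hd : (B x).det ≠ 0) (i j : Fin n) : DifferentiableAt ℝ (fun y => (B y)⁻¹ i j) x := by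
  simp only [Matrix.inv_def, Ring.inverse_eq_inv', Matrix.smul_apply, smul_eq_mul,
    Matrix.adjugate_apply]
  refine ((differentiableAt_matrix_det hB).inv hd).mul (differentiableAt_matrix_det fun k l => ?_)
  by_cases hk : k = j
  · subst hk; simp
  · simpa [Matrix.updateRow_ne hk] using hB k l

theorem differentiableAt_frame (hd : ∀ α i j, DifferentiableAt ℝ (fun y => σ y α i j) x)
    (k α : Fin 3) : DifferentiableAt ℝ (fun y => frame σ y k α) x := by
  have hre : ∀ i j, DifferentiableAt ℝ (fun y => (σ y α i j).re) x := fun i j =>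
    Complex.reCLM.differentiableAt.comp x (hd α i j)
  have him : ∀ i j, DifferentiableAt ℝ (fun y => (σ y α i j).im) x := fun i j =>
    Complex.imCLM.differentiableAt.comp x (hd α i j)
  fin_cases k
  · exact hre 0 1
  · exact (him 0 1).neg
  · exact hre 0 0

theorem differentiableAt_coframe (hd : ∀ α i j, DifferentiableAt ℝ (fun y => σ y α i j) x)
    (h : ∀ᶠ y in 𝓝 x, IsDiracAt σ y) (k β : Fin 3) :
    DifferentiableAt ℝ (fun y => coframe σ y k β) x := by
  have h1 : (fun y => coframe σ y k β) =ᶠ[𝓝 x] fun y => (frameMat σ y)⁻¹ β k :=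
    h.mono fun y hy => hy.coframe_eq k β
  exact (differentiableAt_matrix_inv (differentiableAt_frame hd)
    h.self_of_nhds.det_frameMat_ne_zero β k).congr_of_eventuallyEq h1

/-- Derivative of the duality relation; it moves derivatives from the frame, where the integrand has
them, to the coframe, where the torsion has them. -/
theorem sum_pd_coframe_mul_frame (hd : ∀ α i j, DifferentiableAt ℝ (fun y => σ y α i j) x)
    (h : ∀ᶠ y in 𝓝 x, IsDiracAt σ y) (k l μ : Fin 3) :
    ∑ β, (pd μ (fun y => coframe σ y k β) x * frame σ x l β +
      coframe σ x k β * pd μ (fun y => frame σ y l β) x) = 0 := by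
  have h1 : (fun y => ∑ β, coframe σ y k β * frame σ y l β) =ᶠ[𝓝 x]
      fun _ => if l = k then 1 else 0 := h.mono fun y hy => hy.sum_coframe_mul_frame k l
  have h2 : fderiv ℝ (fun y => ∑ β, coframe σ y k β * frame σ y l β) x = 0 := by
    rw [h1.fderiv_eq, fderiv_fun_const, Pi.zero_apply]
  rw [fderiv_fun_sum fun β _ =>
    (differentiableAt_coframe hd h k β).fun_mul (differentiableAt_frame hd l β)] at h2
  have h4 := DFunLike.congr_fun h2 (EuclideanSpace.single μ (1 : ℝ))
  rw [zero_apply, sum_apply] at h4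
  rw [← h4]
  refine Finset.sum_congr rfl fun β _ => ?_
  rw [fderiv_fun_mul (differentiableAt_coframe hd h k β) (differentiableAt_frame hd l β)]
  simp only [pd, add_apply, smul_apply, smul_eq_mul]
  ring

end Frame

/-! ### The trace of the Hodge-dualised torsion -/

theorem sum_eps (X : Fin 3 → Fin 3 → Fin 3 → ℝ) :
    ∑ i, ∑ j, ∑ k, eps i j k * X i j k =
      X 0 1 2 + X 1 2 0 + X 2 0 1 - X 0 2 1 - X 1 0 2 - X 2 1 0 := by
  simp [eps, Fin.sum_univ_three, Matrix.det_fin_three]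
  ring

/-- The contraction `ε_{mnl} V_mᵘ V_nᵛ ∂_μ 𝐕_{lν}`: the axial torsion of the frame. -/
def axialTorsion (σ : Coord 3 → Fin 3 → Matrix (Fin 2) (Fin 2) ℂ) (x : Coord 3) : ℝ :=
  ∑ m, ∑ n, ∑ l, eps m n l * ∑ μ, ∑ ν,
    frame σ x m μ * frame σ x n ν * pd μ (fun y => coframe σ y l ν) x

/-- Writing the inverse metric as VᵀV expresses the raised torsion through its frame components, the
exterior derivatives of the coframe. -/
theorem IsDiracAt.torsionUp_eq {σ : Coord 3 → Fin 3 → Matrix (Fin 2) (Fin 2) ℂ} {x : Coord 3}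
    (h : IsDiracAt σ x) (α γ δ : Fin 3) :
    torsionUp σ x α γ δ = ∑ m, ∑ n, ∑ l, frame σ x m γ * frame σ x n δ * frame σ x l α *
      ∑ μ, ∑ ν, frame σ x m μ * frame σ x n ν *
        (pd μ (fun y => coframe σ y l ν) x - pd ν (fun y => coframe σ y l μ) x) := by
  simp only [torsionUp, h.gUp_eq, torsion, Gam, Matrix.mul_apply, Matrix.transpose_apply,
    Matrix.of_apply]
  generalize frame σ x = V
  generalize hE : (fun μ l ν => pd μ (fun y => coframe σ y l ν) x) = E
  have hE' : ∀ μ l ν, pd μ (fun y => coframe σ y l ν) x = E μ l ν := fun μ l ν => by rw [← hE]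
  simp only [hE', ← Finset.sum_sub_distrib, ← mul_sub, Finset.sum_mul, Finset.mul_sum]
  simp only [← Finset.sum_product']
  -- Both sides are the same fivefold sum with the summation variables in a different order.
  refine Finset.sum_nbij' (fun p => (p.2.2.2.2, p.2.2.2.1, p.2.2.1, p.1, p.2.1))
    (fun p => (p.2.2.2.1, p.2.2.2.2, p.2.2.1, p.2.1, p.1)) ?_ ?_ ?_ ?_ ?_ <;> intros <;>
    first | rfl | (simp; done) | ring

/-- Contracting V_mᵞV_nᵟV_lᵅ with ε_{γδα} gives det V · ε_{mnl}. The two antisymmetric terms of the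
torsion then contribute equally, which cancels the factor ½ of the Hodge dual. -/
theorem IsDiracAt.trace_starTorsion {σ : Coord 3 → Fin 3 → Matrix (Fin 2) (Fin 2) ℂ}
    {x : Coord 3} (h : IsDiracAt σ x) :
    (starTorsion σ x).trace = sqrtDet σ x * (frameMat σ x).det * axialTorsion σ x := by
  have h1 : (starTorsion σ x).trace =
      sqrtDet σ x / 2 * ∑ γ, ∑ δ, ∑ α, eps γ δ α * torsionUp σ x α γ δ := by
    simp only [Matrix.trace, Matrix.diag_apply, starTorsion, Fin.sum_univ_three]
    ring
  rw [h1, sum_eps]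
  simp only [h.torsionUp_eq, axialTorsion, sum_eps, Matrix.det_fin_three, Matrix.of_apply,
    mul_sub, Finset.sum_sub_distrib]
  generalize hY : (fun m n l => ∑ μ, ∑ ν, frame σ x m μ * frame σ x n ν *
    pd μ (fun y => coframe σ y l ν) x) = Y
  have hY1 : ∀ m n l, ∑ μ, ∑ ν, frame σ x m μ * frame σ x n ν *
      pd μ (fun y => coframe σ y l ν) x = Y m n l := fun m n l => by rw [← hY]
  have hY2 : ∀ m n l, ∑ μ, ∑ ν, frame σ x m μ * frame σ x n ν *
      pd ν (fun y => coframe σ y l μ) x = Y n m l := fun m n l => by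
    rw [← hY, Finset.sum_comm]
    simp only [mul_comm (frame σ x m _)]
  simp only [hY1, hY2]
  simp only [Fin.sum_univ_three]
  ring

/-! ### The positive eigenvalue and smooth normalised eigenvectors -/

/-- The length `|p|`, which is the positive eigenvalue of `pauliMat p`. -/
def len (p : Fin 3 → ℝ) : ℝ := Real.sqrt (sqLen p)

theorem len_sq (p : Fin 3 → ℝ) : len p ^ 2 = sqLen p := Real.sq_sqrt (sqLen_nonneg p)

theorem len_pos {p : Fin 3 → ℝ} (hp : p ≠ 0) : 0 < len p := Real.sqrt_pos.2 (sqLen_pos hp)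

theorem contDiff_sqLen : ContDiff ℝ ∞ sqLen := by
  unfold sqLen
  fun_prop

theorem contDiffAt_len {p : Fin 3 → ℝ} (hp : p ≠ 0) : ContDiffAt ℝ ∞ len p :=
  contDiff_sqLen.contDiffAt.sqrt (sqLen_pos hp).ne'

/-- The eigenvector of `pauliMat p` which is regular away from `p₁ = p₂ = 0`, `p₃ ≤ 0`. -/
def eigPlus (p : Fin 3 → ℝ) : Fin 2 → ℂ :=
  -- The first column of |p| + p·s, which lies in the eigenspace because (p·s)² = |p|², divided by
  -- its length. The second column is used in `eigMinus`.
  (Real.sqrt (2 * len p * (len p + p 2)))⁻¹ •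
    ![((len p + p 2 : ℝ) : ℂ), p 0 + Complex.I * p 1]

/-- The eigenvector of `pauliMat p` which is regular away from `p₁ = p₂ = 0`, `p₃ ≥ 0`. -/
def eigMinus (p : Fin 3 → ℝ) : Fin 2 → ℂ :=
  (Real.sqrt (2 * len p * (len p - p 2)))⁻¹ •
    ![p 0 - Complex.I * p 1, ((len p - p 2 : ℝ) : ℂ)]

theorem len_sq_complex (p : Fin 3 → ℝ) :
    (len p : ℂ) ^ 2 = (p 0 : ℂ) ^ 2 + (p 1 : ℂ) ^ 2 + (p 2 : ℂ) ^ 2 := by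
  exact_mod_cast len_sq p

theorem pauliMat_mulVec_eigPlus (p : Fin 3 → ℝ) :
    (pauliMat p).mulVec (eigPlus p) = (len p : ℂ) • eigPlus p := by
  rw [eigPlus, Matrix.mulVec_smul, smul_comm]
  congr 1
  have h := len_sq_complex p
  ext i
  fin_cases i
  · simp [pauliMat, Matrix.mulVec, dotProduct, Fin.sum_univ_two]
    linear_combination -h - (p 1 : ℂ) ^ 2 * Complex.I_sq
  · simp [pauliMat, Matrix.mulVec, dotProduct, Fin.sum_univ_two]
    ring

theorem pauliMat_mulVec_eigMinus (p : Fin 3 → ℝ) :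
    (pauliMat p).mulVec (eigMinus p) = (len p : ℂ) • eigMinus p := by
  rw [eigMinus, Matrix.mulVec_smul, smul_comm]
  congr 1
  have h := len_sq_complex p
  ext i
  fin_cases i
  · simp [pauliMat, Matrix.mulVec, dotProduct, Fin.sum_univ_two]
    ring
  · simp [pauliMat, Matrix.mulVec, dotProduct, Fin.sum_univ_two]
    linear_combination -h - (p 1 : ℂ) ^ 2 * Complex.I_sq

theorem eigPlus_normalised {p : Fin 3 → ℝ} (h0 : 0 < len p) (h1 : 0 < len p + p 2) :
    dotProduct (star (eigPlus p)) (eigPlus p) = 1 := by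
  have hs : 0 < 2 * len p * (len p + p 2) := by positivity
  have hq : ((Real.sqrt (2 * len p * (len p + p 2)) : ℝ) : ℂ) ^ 2 =
      2 * len p * (len p + p 2) := by exact_mod_cast Real.sq_sqrt hs.le
  have hne : ((Real.sqrt (2 * len p * (len p + p 2)) : ℝ) : ℂ) ≠ 0 :=
    Complex.ofReal_ne_zero.2 (Real.sqrt_pos.2 hs).ne'
  rw [eigPlus, star_smul, smul_dotProduct, dotProduct_smul]
  simp [dotProduct, Fin.sum_univ_two]
  field_simp
  rw [hq]
  linear_combination -len_sq_complex p - (p 1 : ℂ) ^ 2 * Complex.I_sq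

theorem eigMinus_normalised {p : Fin 3 → ℝ} (h0 : 0 < len p) (h1 : 0 < len p - p 2) :
    dotProduct (star (eigMinus p)) (eigMinus p) = 1 := by
  have hs : 0 < 2 * len p * (len p - p 2) := by positivity
  have hq : ((Real.sqrt (2 * len p * (len p - p 2)) : ℝ) : ℂ) ^ 2 =
      2 * len p * (len p - p 2) := by exact_mod_cast Real.sq_sqrt hs.le
  have hne : ((Real.sqrt (2 * len p * (len p - p 2)) : ℝ) : ℂ) ≠ 0 :=
    Complex.ofReal_ne_zero.2 (Real.sqrt_pos.2 hs).ne'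
  rw [eigMinus, star_smul, smul_dotProduct, dotProduct_smul]
  simp [dotProduct, Fin.sum_univ_two]
  field_simp
  rw [hq]
  linear_combination -len_sq_complex p - (p 1 : ℂ) ^ 2 * Complex.I_sq

theorem contDiff_ofReal_apply (k : Fin 3) : ContDiff ℝ ∞ (fun p : Fin 3 → ℝ => (p k : ℂ)) :=
  Complex.ofRealCLM.contDiff.comp (contDiff_apply ℝ ℝ k)

theorem contDiffAt_eigPlus {p : Fin 3 → ℝ} (hp : p ≠ 0) (h1 : 0 < len p + p 2) :
    ContDiffAt ℝ ∞ eigPlus p := by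
  have hl := contDiffAt_len hp
  have h2 : ContDiffAt ℝ ∞ (fun p : Fin 3 → ℝ => len p + p 2) p :=
    hl.add (contDiff_apply ℝ ℝ 2).contDiffAt
  have hs : 0 < 2 * len p * (len p + p 2) := by have := len_pos hp; positivity
  have h3 : ContDiffAt ℝ ∞ (fun p => (Real.sqrt (2 * len p * (len p + p 2)))⁻¹) p :=
    (((contDiffAt_const.mul hl).mul h2).sqrt hs.ne').inv (Real.sqrt_pos.2 hs).ne'
  refine h3.smul (contDiffAt_pi.2 fun i => ?_)
  fin_cases i
  · exact Complex.ofRealCLM.contDiff.contDiffAt.comp p h2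
  · exact ((contDiff_ofReal_apply 0).add
      (contDiff_const.mul (contDiff_ofReal_apply 1))).contDiffAt

theorem contDiffAt_eigMinus {p : Fin 3 → ℝ} (hp : p ≠ 0) (h1 : 0 < len p - p 2) :
    ContDiffAt ℝ ∞ eigMinus p := by
  have hl := contDiffAt_len hp
  have h2 : ContDiffAt ℝ ∞ (fun p : Fin 3 → ℝ => len p - p 2) p :=
    hl.sub (contDiff_apply ℝ ℝ 2).contDiffAt
  have hs : 0 < 2 * len p * (len p - p 2) := by have := len_pos hp; positivity
  have h3 : ContDiffAt ℝ ∞ (fun p => (Real.sqrt (2 * len p * (len p - p 2)))⁻¹) p :=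
    (((contDiffAt_const.mul hl).mul h2).sqrt hs.ne').inv (Real.sqrt_pos.2 hs).ne'
  refine h3.smul (contDiffAt_pi.2 fun i => ?_)
  fin_cases i
  · exact ((contDiff_ofReal_apply 0).sub
      (contDiff_const.mul (contDiff_ofReal_apply 1))).contDiffAt
  · exact Complex.ofRealCLM.contDiff.contDiffAt.comp p h2

theorem pauliMat_mul_self (p : Fin 3 → ℝ) :
    pauliMat p * pauliMat p = (sqLen p : ℂ) • (1 : Matrix (Fin 2) (Fin 2) ℂ) := by
  ext i j
  fin_cases i <;> fin_cases j <;>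
    simp [pauliMat, Matrix.mul_apply, Fin.sum_univ_two, sqLen] <;>
    first
    | linear_combination -(p 1 : ℂ) ^ 2 * Complex.I_sq
    | ring

theorem exists_normalised_eigenvector {p : Fin 3 → ℝ} (hp : p ≠ 0) :
    ∃ w : Fin 2 → ℂ, dotProduct (star w) w = 1 ∧ (pauliMat p).mulVec w = (len p : ℂ) • w := by
  have h0 := len_pos hp
  by_cases h : 0 ≤ p 2
  · exact ⟨_, eigPlus_normalised h0 (by linarith), pauliMat_mulVec_eigPlus p⟩
  · exact ⟨_, eigMinus_normalised h0 (by linarith), pauliMat_mulVec_eigMinus p⟩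

/-- From (p·s)² = |p|² any eigenvalue satisfies r² = |p|², and positivity selects r = |p|. -/
theorem isPositiveEigenvalue_iff_eq_len {p : Fin 3 → ℝ} (hp : p ≠ 0) (r : ℝ) :
    (0 < r ∧ ∃ w : Fin 2 → ℂ, w ≠ 0 ∧ (pauliMat p).mulVec w = (r : ℂ) • w) ↔ len p = r := by
  constructor
  · rintro ⟨hr, w, hw, he⟩
    have h2 : (pauliMat p * pauliMat p).mulVec w = ((r : ℂ) * r) • w := by
      rw [← Matrix.mulVec_mulVec, he, Matrix.mulVec_smul, he, smul_smul]
    rw [pauliMat_mul_self, Matrix.smul_mulVec, Matrix.one_mulVec] at h2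
    have h3 : (sqLen p : ℂ) = (r : ℂ) * r := smul_left_injective ℂ hw h2
    have h4 : sqLen p = r * r := by exact_mod_cast h3
    rw [len, h4, Real.sqrt_mul_self hr.le]
  · rintro rfl
    obtain ⟨w, hw, he⟩ := exists_normalised_eigenvector hp
    refine ⟨len_pos hp, w, ?_, he⟩
    rintro rfl
    simp at hw

section Smooth

variable {σ : Coord 3 → Fin 3 → Matrix (Fin 2) (Fin 2) ℂ} {x : Coord 3}

theorem contDiffAt_frame (hd : ∀ α i j, ContDiffAt ℝ ∞ (fun y => σ y α i j) x)
    (k α : Fin 3) : ContDiffAt ℝ ∞ (fun y => frame σ y k α) x := by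
  have hre : ∀ i j, ContDiffAt ℝ ∞ (fun y => (σ y α i j).re) x := fun i j =>
    Complex.reCLM.contDiff.contDiffAt.comp x (hd α i j)
  have him : ∀ i j, ContDiffAt ℝ ∞ (fun y => (σ y α i j).im) x := fun i j =>
    Complex.imCLM.contDiff.contDiffAt.comp x (hd α i j)
  fin_cases k
  · exact hre 0 1
  · exact (him 0 1).neg
  · exact hre 0 0

theorem contDiffAt_momentum (hd : ∀ α i j, ContDiffAt ℝ ∞ (fun y => σ y α i j) x)
    (ξ : Coord 3) :
    ContDiffAt ℝ ∞ (fun q : Coord 3 × Coord 3 => momentum σ q.1 q.2) (x, ξ) := by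
  refine contDiffAt_pi.2 fun k => ContDiffAt.sum fun α _ => ContDiffAt.mul ?_ ?_
  · exact ContDiffAt.comp (g := fun y => frame σ y k α) (x, ξ) (contDiffAt_frame hd k α)
      contDiffAt_fst
  · exact ((EuclideanSpace.proj (𝕜 := ℝ) α : Coord 3 →L[ℝ] ℝ).contDiff.comp
      contDiff_snd).contDiffAt

/-- The local smooth normalised eigenvector near the point `(x, ξ)`. -/
def localEigenvector (σ : Coord 3 → Fin 3 → Matrix (Fin 2) (Fin 2) ℂ) (x ξ y η : Coord 3) :
    Fin 2 → ℂ :=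
  -- The base point (x, ξ), not the variable point (y, η), selects the column, so a single smooth
  -- formula is used near (x, ξ) and its denominator stays away from zero there.
  if 0 ≤ momentum σ x ξ 2 then eigPlus (momentum σ y η) else eigMinus (momentum σ y η)

theorem localEigenvector_contDiffAt (hd : ∀ α i j, ContDiffAt ℝ ∞ (fun y => σ y α i j) x)
    (h : IsDiracAt σ x) {ξ : Coord 3} (hξ : ξ ≠ 0) :
    ContDiffAt ℝ ∞ (fun q : Coord 3 × Coord 3 => localEigenvector σ x ξ q.1 q.2) (x, ξ) := by
  have hp := h.momentum_ne_zero hξ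
  have h0 := len_pos hp
  unfold localEigenvector
  split_ifs with hs
  · exact ContDiffAt.comp (x, ξ) (contDiffAt_eigPlus hp (by linarith)) (contDiffAt_momentum hd ξ)
  · exact ContDiffAt.comp (x, ξ) (contDiffAt_eigMinus hp (by linarith)) (contDiffAt_momentum hd ξ)

theorem localEigenvector_normalised (hd : ∀ α i j, ContDiffAt ℝ ∞ (fun y => σ y α i j) x)
    (h : IsDiracAt σ x) {ξ : Coord 3} (hξ : ξ ≠ 0) :
    ∀ᶠ q in 𝓝 (x, ξ), dotProduct (star (localEigenvector σ x ξ q.1 q.2))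
      (localEigenvector σ x ξ q.1 q.2) = 1 := by
  have hp := h.momentum_ne_zero hξ
  have h0 := len_pos hp
  have hm := (contDiffAt_momentum hd ξ).continuousAt
  have hl : ContinuousAt (fun q : Coord 3 × Coord 3 => len (momentum σ q.1 q.2)) (x, ξ) :=
    ContinuousAt.comp (g := len) (f := fun q : Coord 3 × Coord 3 => momentum σ q.1 q.2)
      (contDiffAt_len hp).continuousAt hm
  have h2 : ContinuousAt (fun q : Coord 3 × Coord 3 => momentum σ q.1 q.2 2) (x, ξ) :=
    continuousAt_pi.1 hm 2
  unfold localEigenvector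
  split_ifs with hs
  · have hadd : 0 < len (momentum σ x ξ) + momentum σ x ξ 2 := by linarith
    filter_upwards [hl.eventually (lt_mem_nhds h0),
      (hl.add h2).eventually (lt_mem_nhds (hadd))] with q hq1 hq2
    exact eigPlus_normalised hq1 hq2
  · have hsub : 0 < len (momentum σ x ξ) - momentum σ x ξ 2 := by linarith
    filter_upwards [hl.eventually (lt_mem_nhds h0),
      (hl.sub h2).eventually (lt_mem_nhds (hsub))] with q hq1 hq2
    exact eigMinus_normalised hq1 hq2

/-- A smooth symbol of this kind has exactly one positive eigenvalue, with locally smooth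
normalised eigenvectors. -/
theorem nonempty_positiveEigensystem {U : Set (Coord 3)} (hU : IsOpen U)
    (hd : ∀ α i j, ContDiffOn ℝ ∞ (fun y => σ y α i j) U) (h : ∀ x ∈ U, IsDiracAt σ x) :
    Nonempty (PositiveEigensystem U (linSymbol σ) 1) := by
  have hd' : ∀ x ∈ U, ∀ α i j, ContDiffAt ℝ ∞ (fun y => σ y α i j) x :=
    fun x hx α i j => (hd α i j).contDiffAt (hU.mem_nhds hx)
  refine ⟨⟨fun _ x ξ => len (momentum σ x ξ), fun _ _ _ _ => Subsingleton.strictMono _, ?_,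
    fun _ => localEigenvector σ, ?_, ?_, ?_⟩⟩
  · intro x hx ξ hξ r
    rw [(h x hx).linSymbol_eq, isPositiveEigenvalue_iff_eq_len ((h x hx).momentum_ne_zero hξ)]
    exact exists_const (Fin 1)
  · exact fun _ x hx ξ hξ => localEigenvector_contDiffAt (hd' x hx) (h x hx) hξ
  · intro _ x hx ξ hξ
    have hn : ∀ᶠ q : Coord 3 × Coord 3 in 𝓝 (x, ξ), q.1 ∈ U :=
      continuousAt_fst.eventually (hU.mem_nhds hx)
    filter_upwards [hn] with q hq
    rw [(h _ hq).linSymbol_eq, localEigenvector]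
    split_ifs
    · exact pauliMat_mulVec_eigPlus _
    · exact pauliMat_mulVec_eigMinus _
  · exact fun _ x hx ξ hξ => localEigenvector_normalised (hd' x hx) (h x hx) hξ

end Smooth

/-! ### The brackets of a normalised eigenvector -/

theorem pauliMat_00 (p : Fin 3 → ℝ) : pauliMat p 0 0 = p 2 := rfl
theorem pauliMat_01 (p : Fin 3 → ℝ) : pauliMat p 0 1 = p 0 - Complex.I * p 1 := rfl
theorem pauliMat_10 (p : Fin 3 → ℝ) : pauliMat p 1 0 = p 0 + Complex.I * p 1 := rfl
theorem pauliMat_11 (p : Fin 3 → ℝ) : pauliMat p 1 1 = -p 2 := rfl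

/-- The entries of `v v*` for a normalised eigenvector `v`. -/
theorem eigenvector_mul_star {p : Fin 3 → ℝ} (hp : p ≠ 0) {w : Fin 2 → ℂ}
    (hw : dotProduct (star w) w = 1) (he : (pauliMat p).mulVec w = (len p : ℂ) • w)
    (i j : Fin 2) :
    w i * star (w j) = 1 / 2 * ((1 : Matrix (Fin 2) (Fin 2) ℂ) i j +
      ((len p)⁻¹ : ℝ) * pauliMat p i j) := by
  have hl : (len p : ℂ) ≠ 0 := Complex.ofReal_ne_zero.2 (len_pos hp).ne'
  have h0 := congrFun he 0
  have h1 := congrFun he 1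
  simp only [Matrix.mulVec, dotProduct, Fin.sum_univ_two, pauliMat_00, pauliMat_01, pauliMat_10,
    pauliMat_11, Pi.smul_apply, smul_eq_mul, Pi.star_apply] at h0 h1 hw
  have k0 := congrArg star h0
  have k1 := congrArg star h1
  simp only [Complex.star_def, map_add, map_mul, map_sub, map_neg, Complex.conj_I,
    Complex.conj_ofReal] at k0 k1 hw ⊢
  push_cast
  fin_cases i <;> fin_cases j <;>
    simp only [Fin.zero_eta, Fin.mk_one, Matrix.one_apply_eq, pauliMat_00, pauliMat_01, pauliMat_10,
      pauliMat_11, ne_eq, zero_ne_one, one_ne_zero, not_false_eq_true, Matrix.one_apply_ne] <;>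
    generalize (starRingEnd ℂ) (w 0) = a' at * <;> generalize (starRingEnd ℂ) (w 1) = b' at * <;>
    generalize w 0 = a at * <;> generalize w 1 = b at * <;> field_simp
  · linear_combination (len p + p 2 : ℂ) * hw - a' * h0 + b * k1
  · linear_combination (p 0 - Complex.I * p 1 : ℂ) * hw - b' * h0 - a * k1
  · linear_combination (p 0 + Complex.I * p 1 : ℂ) * hw - a' * h1 - b * k0
  · linear_combination (len p - p 2 : ℂ) * hw + a' * h0 - b * k1

/-- Entries of `pauliMat` as continuous linear maps. -/
def pauliEntry (i j : Fin 2) : (Fin 3 → ℝ) →L[ℝ] ℂ :=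
  LinearMap.toContinuousLinearMap
    { toFun := fun p => pauliMat p i j
      map_add' := fun p q => by
        fin_cases i <;> fin_cases j <;> simp [pauliMat] <;> ring
      map_smul' := fun c p => by
        fin_cases i <;> fin_cases j <;> simp [pauliMat] <;> ring }

theorem pauliEntry_apply (i j : Fin 2) (p : Fin 3 → ℝ) : pauliEntry i j p = pauliMat p i j := rfl

/-- Differentiating `v v* = (1 + A₁ / |p|) / 2`. -/
theorem pd_eigenvector_mul_star {n : ℕ} {w : Coord n → Fin 2 → ℂ} {p : Coord n → Fin 3 → ℝ}
    {x : Coord n} (hw : DifferentiableAt ℝ w x) (hp : DifferentiableAt ℝ p x) (hp0 : p x ≠ 0)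
    (hn : ∀ᶠ y in 𝓝 x, dotProduct (star (w y)) (w y) = 1)
    (he : ∀ᶠ y in 𝓝 x, (pauliMat (p y)).mulVec (w y) = (len (p y) : ℂ) • w y) (α : Fin n) :
    ∃ t : ℝ, ∀ i j, pd α w x i * star (w x j) + w x i * star (pd α w x j) =
      1 / 2 * (t * pauliMat (p x) i j + ((len (p x))⁻¹ : ℝ) * pauliMat (pd α p x) i j) := by
  have hinv : DifferentiableAt ℝ (fun y => (len (p y))⁻¹) x :=
    (((contDiffAt_len hp0).differentiableAt (by simp)).comp x hp).inv (len_pos hp0).ne'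
  -- The derivative of 1/|p| multiplies p·s itself, so its value is irrelevant: it drops out of the
  -- triple product later.
  refine ⟨pd α (fun y => (len (p y))⁻¹) x, fun i j => ?_⟩
  have hwi : ∀ i, HasFDerivAt (fun y => w y i)
      ((ContinuousLinearMap.proj (R := ℝ) (φ := fun _ : Fin 2 => ℂ) i).comp (fderiv ℝ w x)) x :=
    fun i => (ContinuousLinearMap.proj (R := ℝ) (φ := fun _ : Fin 2 => ℂ) i).hasFDerivAt.comp x
      hw.hasFDerivAt
  have h1 := (hwi i).mul (hwi j).star
  have h2 : HasFDerivAt (fun y => pauliMat (p y) i j) ((pauliEntry i j).comp (fderiv ℝ p x)) x :=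
    (pauliEntry i j).hasFDerivAt.comp x hp.hasFDerivAt
  have h3 := ((hinv.hasFDerivAt.smul h2).const_add ((1 : Matrix (Fin 2) (Fin 2) ℂ) i j)).const_smul
    (1 / 2 : ℝ)
  have h4 := h3.congr_of_eventuallyEq (f₁ := fun y => w y i * star (w y j)) (by
    filter_upwards [hn, he, hp.continuousAt.eventually_ne hp0] with y h1 h2 h3
    rw [eigenvector_mul_star h3 h1 h2]
    simp [Complex.real_smul]
    ring)
  have h5 := DFunLike.congr_fun (h1.unique h4) (EuclideanSpace.single α (1 : ℝ))
  simp [Complex.real_smul, pauliEntry_apply] at h5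
  simp only [pd, Complex.star_def]
  push_cast
  linear_combination h5

/-- The determinant `p · (q × r)`. -/
def tripleProd (p q r : Fin 3 → ℝ) : ℝ :=
  p 0 * (q 1 * r 2 - q 2 * r 1) + p 1 * (q 2 * r 0 - q 0 * r 2) + p 2 * (q 0 * r 1 - q 1 * r 0)

/-- With P = ww*, the vectors a and c being two derivatives of w, the left side equals tr(P[∂P,
∂'P]); the identities w*a + a*w = 0 and w*c + c*w = 0 follow because ∂P and ∂'P are trace-free. The
commutator of Pauli combinations is 2i times the cross product, and the terms s p and t p are killed
by the triple product with p. -/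
theorem bracket_eq {p q r : Fin 3 → ℝ} {w a c : Fin 2 → ℂ} {l s t : ℝ}
    (hw : dotProduct (star w) w = 1)
    (hP : ∀ i j, w i * star (w j) = 1 / 2 * ((1 : Matrix (Fin 2) (Fin 2) ℂ) i j +
      (l : ℂ) * pauliMat p i j))
    (ha : ∀ i j, a i * star (w j) + w i * star (a j) =
      1 / 2 * (s * pauliMat p i j + (l : ℂ) * pauliMat q i j))
    (hc : ∀ i j, c i * star (w j) + w i * star (c j) =
      1 / 2 * (t * pauliMat p i j + (l : ℂ) * pauliMat r i j)) :
    dotProduct (star a) c - dotProduct (star c) a =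
      Complex.I / 2 * (l : ℂ) ^ 3 * (tripleProd p q r : ℂ) := by
  have h1 : dotProduct (star a) c - dotProduct (star c) a =
      ∑ i, ∑ j, ∑ k, (w k * star (w i)) *
        ((a i * star (w j) + w i * star (a j)) * (c j * star (w k) + w j * star (c k)) -
         (c i * star (w j) + w i * star (c j)) * (a j * star (w k) + w j * star (a k))) := by
    have ha' : a 0 * star (w 0) + w 0 * star (a 0) + (a 1 * star (w 1) + w 1 * star (a 1)) = 0 := by
      rw [ha, ha, pauliMat_00, pauliMat_11, pauliMat_00, pauliMat_11]; ring
    have hc' : c 0 * star (w 0) + w 0 * star (c 0) + (c 1 * star (w 1) + w 1 * star (c 1)) = 0 := by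
      rw [hc, hc, pauliMat_00, pauliMat_11, pauliMat_00, pauliMat_11]; ring
    clear hP ha hc
    simp only [dotProduct, Fin.sum_univ_two, Pi.star_apply] at hw ⊢
    generalize star (w 0) = w0' at *
    generalize star (w 1) = w1' at *
    generalize star (a 0) = a0' at *
    generalize star (a 1) = a1' at *
    generalize star (c 0) = c0' at *
    generalize star (c 1) = c1' at *
    linear_combination
      (-(w0' * w 0 + w1' * w 1 + 1) * (a0' * c 0 + a1' * c 1 - (c0' * a 0 + c1' * a 1))) * hw -
      (w0' * w 0 + w1' * w 1) * (w0' * a 0 + w1' * a 1) * hc' +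
      (w0' * w 0 + w1' * w 1) * (w0' * c 0 + w1' * c 1) * ha'
  rw [h1]
  simp only [ha, hc, hP]
  clear hw hP ha hc h1
  simp only [Fin.sum_univ_two, pauliMat_00, pauliMat_01, pauliMat_10, pauliMat_11, tripleProd,
    Matrix.one_apply_eq, ne_eq, zero_ne_one, one_ne_zero, not_false_eq_true, Matrix.one_apply_ne]
  push_cast
  ring

/-- As p·s = l(2P - 1), the matrix p·s - l is -2l(1 - P). The projection P contributes (a*w)(w*c) -
(c*w)(w*a), which is zero since a*w = -w*a and c*w = -w*c. -/
theorem bracket₃_eq {p q r : Fin 3 → ℝ} {w a c : Fin 2 → ℂ} {l s t : ℝ} (hl : l ≠ 0)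
    (hP : ∀ i j, w i * star (w j) = 1 / 2 * ((1 : Matrix (Fin 2) (Fin 2) ℂ) i j +
      (l⁻¹ : ℝ) * pauliMat p i j))
    (ha : ∀ i j, a i * star (w j) + w i * star (a j) =
      1 / 2 * (s * pauliMat p i j + (l⁻¹ : ℝ) * pauliMat q i j))
    (hc : ∀ i j, c i * star (w j) + w i * star (c j) =
      1 / 2 * (t * pauliMat p i j + (l⁻¹ : ℝ) * pauliMat r i j)) :
    dotProduct (star a) ((pauliMat p - (l : ℂ) • (1 : Matrix (Fin 2) (Fin 2) ℂ)).mulVec c) -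
      dotProduct (star c) ((pauliMat p - (l : ℂ) • (1 : Matrix (Fin 2) (Fin 2) ℂ)).mulVec a) =
      -2 * l * (dotProduct (star a) c - dotProduct (star c) a) := by
  have hA : ∀ i j, pauliMat p i j =
      l * (2 * (w i * star (w j)) - (1 : Matrix (Fin 2) (Fin 2) ℂ) i j) := fun i j => by
    rw [hP]
    push_cast
    have : (l : ℂ) ≠ 0 := Complex.ofReal_ne_zero.2 hl
    field_simp
    ring
  have ha' : a 0 * star (w 0) + w 0 * star (a 0) + (a 1 * star (w 1) + w 1 * star (a 1)) = 0 := by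
    rw [ha, ha, pauliMat_00, pauliMat_11, pauliMat_00, pauliMat_11]; ring
  have hc' : c 0 * star (w 0) + w 0 * star (c 0) + (c 1 * star (w 1) + w 1 * star (c 1)) = 0 := by
    rw [hc, hc, pauliMat_00, pauliMat_11, pauliMat_00, pauliMat_11]; ring
  simp only [dotProduct, Matrix.mulVec, Fin.sum_univ_two, Pi.star_apply, Matrix.sub_apply,
    Matrix.smul_apply, hA, Matrix.one_apply_eq, ne_eq, zero_ne_one, one_ne_zero, not_false_eq_true,
    Matrix.one_apply_ne, smul_eq_mul]
  clear hP ha hc hA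
  generalize star (w 0) = w0' at *
  generalize star (w 1) = w1' at *
  generalize star (a 0) = a0' at *
  generalize star (a 1) = a1' at *
  generalize star (c 0) = c0' at *
  generalize star (c 1) = c1' at *
  linear_combination 2 * (l : ℂ) * (w0' * c 0 + w1' * c 1) * ha' -
    2 * (l : ℂ) * (w0' * a 0 + w1' * a 1) * hc'

/-! ### The integrand of the second coefficient -/

section Integrand

variable {σ : Coord 3 → Fin 3 → Matrix (Fin 2) (Fin 2) ℂ} {U : Set (Coord 3)} {k : ℕ}

theorem PositiveEigensystem.h_eq (S : PositiveEigensystem U (linSymbol σ) k)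
    (h : ∀ x ∈ U, IsDiracAt σ x) (j : Fin k) {x ξ : Coord 3} (hx : x ∈ U) (hξ : ξ ≠ 0) :
    S.h j x ξ = len (momentum σ x ξ) := by
  have h1 := (S.isPositiveEigenvalue_iff x hx ξ hξ (S.h j x ξ)).1 ⟨j, rfl⟩
  rw [(h x hx).linSymbol_eq] at h1
  exact ((isPositiveEigenvalue_iff_eq_len ((h x hx).momentum_ne_zero hξ) _).1 h1).symm

/-- Strictly increasing values that all equal |p| leave at most one index, and the existence of the
eigenvalue gives one. Any nonzero covector serves as a test. -/
theorem PositiveEigensystem.card_eq_one (S : PositiveEigensystem U (linSymbol σ) k)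
    (h : ∀ x ∈ U, IsDiracAt σ x) {x : Coord 3} (hx : x ∈ U) : k = 1 := by
  have hξ : (EuclideanSpace.single 0 1 : Coord 3) ≠ 0 := by simp
  set ξ : Coord 3 := EuclideanSpace.single 0 1
  have hsub : Subsingleton (Fin k) := ⟨fun i j => (S.strictMono x hx ξ hξ).injective (by
    simp only [S.h_eq h _ hx hξ])⟩
  obtain ⟨j, -⟩ := (S.isPositiveEigenvalue_iff x hx ξ hξ (len (momentum σ x ξ))).2 (by
    rw [(h x hx).linSymbol_eq, isPositiveEigenvalue_iff_eq_len ((h x hx).momentum_ne_zero hξ)])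
  have h1 : k ≤ 1 := Fin.subsingleton_iff_le_one.1 hsub
  have h2 := j.pos
  omega

theorem pd_momentum_right (x ξ : Coord 3) (α : Fin 3) :
    pd α (fun η => momentum σ x η) ξ = fun k => frame σ x k α := by
  let L : Coord 3 →L[ℝ] (Fin 3 → ℝ) := ContinuousLinearMap.pi fun k =>
    ∑ α, frame σ x k α • (EuclideanSpace.proj (𝕜 := ℝ) α : Coord 3 →L[ℝ] ℝ)
  have hL : (fun η => momentum σ x η) = L := by
    funext η k
    simp [L, momentum]
  rw [pd, hL, L.fderiv]
  funext k
  simp [L]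

theorem pd_momentum_left {x : Coord 3}
    (hd : ∀ α i j, ContDiffAt ℝ ∞ (fun y => σ y α i j) x) (ξ : Coord 3) (α : Fin 3) :
    pd α (fun y => momentum σ y ξ) x =
      fun k => ∑ β, pd α (fun y => frame σ y k β) x * ξ β := by
  have h1 : ∀ k, HasFDerivAt (fun y => momentum σ y ξ k)
      (∑ β, ξ β • fderiv ℝ (fun y => frame σ y k β) x) x := fun k =>
    HasFDerivAt.fun_sum fun β _ =>
      (((contDiffAt_frame hd k β).differentiableAt (by simp)).hasFDerivAt.mul_const (ξ β))
  rw [pd, (hasFDerivAt_pi.2 h1).fderiv]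
  funext k
  simp [pd, mul_comm]

theorem pd_star {n m : ℕ} {w : Coord n → Fin m → ℂ} {x : Coord n} (α : Fin n) :
    pd α (fun y => star (w y)) x = star (pd α w x) := by
  rw [pd, fderiv_star]
  rfl

/-- The integrand of the second coefficient in terms of the frame. -/
theorem PositiveEigensystem.integrand_eq (S : PositiveEigensystem U (linSymbol σ) k)
    (hU : IsOpen U) (hd : ∀ α i j, ContDiffOn ℝ ∞ (fun y => σ y α i j) U)
    (h : ∀ x ∈ U, IsDiracAt σ x) (A₀ : Coord 3 → Coord 3 → Matrix (Fin 2) (Fin 2) ℂ)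
    (j : Fin k) {x ξ : Coord 3} (hx : x ∈ U) (hξ : ξ ≠ 0) :
    S.integrand A₀ j x ξ =
      1 / 2 * ((subprincipal (linSymbol σ) A₀ x ξ).trace + ((len (momentum σ x ξ))⁻¹ : ℝ) *
        ∑ i, ∑ i', subprincipal (linSymbol σ) A₀ x ξ i i' * pauliMat (momentum σ x ξ) i' i) -
      3 / 4 * (((len (momentum σ x ξ))⁻¹ ^ 2 : ℝ) * ∑ α, (tripleProd (momentum σ x ξ)
        (fun k => ∑ β, pd α (fun y => frame σ y k β) x * ξ β) (fun k => frame σ x k α) : ℂ)) := by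
  have hd' : ∀ α i j, ContDiffAt ℝ ∞ (fun y => σ y α i j) x :=
    fun α i j => (hd α i j).contDiffAt (hU.mem_nhds hx)
  have hp0 := (h x hx).momentum_ne_zero hξ
  have hl : len (momentum σ x ξ) ≠ 0 := (len_pos hp0).ne'
  have hS := (S.smooth j x hx ξ hξ).differentiableAt (n := ∞) (by simp)
  have hm := (contDiffAt_momentum hd' ξ).differentiableAt (n := ∞) (by simp)
  have hn := S.normalised j x hx ξ hξ
  have he : ∀ᶠ q in 𝓝 (x, ξ), (pauliMat (momentum σ q.1 q.2)).mulVec (S.v j x ξ q.1 q.2) =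
      (len (momentum σ q.1 q.2) : ℂ) • S.v j x ξ q.1 q.2 := by
    filter_upwards [S.eigenvector j x hx ξ hξ,
      (continuousAt_fst (p := (x, ξ))).eventually (hU.mem_nhds hx),
      (continuousAt_snd (p := (x, ξ))).eventually_ne hξ] with q h1 h2 h3
    rwa [(h _ h2).linSymbol_eq, S.h_eq h j h2 h3] at h1
  have tl : Tendsto (fun y : Coord 3 => (y, ξ)) (𝓝 x) (𝓝 (x, ξ)) :=
    Continuous.tendsto' (by fun_prop) _ _ rfl
  have tr : Tendsto (fun η : Coord 3 => (x, η)) (𝓝 ξ) (𝓝 (x, ξ)) :=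
    Continuous.tendsto' (by fun_prop) _ _ rfl
  have dl : DifferentiableAt ℝ (fun y : Coord 3 => (y, ξ)) x := by fun_prop
  have dr : DifferentiableAt ℝ (fun η : Coord 3 => (x, η)) ξ := by fun_prop
  have vl : DifferentiableAt ℝ (fun y => S.v j x ξ y ξ) x :=
    DifferentiableAt.comp (g := fun q : Coord 3 × Coord 3 => S.v j x ξ q.1 q.2) x hS dl
  have vr : DifferentiableAt ℝ (fun η => S.v j x ξ x η) ξ :=
    DifferentiableAt.comp (g := fun q : Coord 3 × Coord 3 => S.v j x ξ q.1 q.2) ξ hS dr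
  have ml : DifferentiableAt ℝ (fun y => momentum σ y ξ) x :=
    DifferentiableAt.comp (g := fun q : Coord 3 × Coord 3 => momentum σ q.1 q.2) x hm dl
  have mr : DifferentiableAt ℝ (fun η => momentum σ x η) ξ :=
    DifferentiableAt.comp (g := fun q : Coord 3 × Coord 3 => momentum σ q.1 q.2) ξ hm dr
  have hP := eigenvector_mul_star hp0 hn.self_of_nhds he.self_of_nhds
  have hnx : dotProduct (star (S.v j x ξ x ξ)) (S.v j x ξ x ξ) = 1 := hn.self_of_nhds
  have hX : ∀ α, _ := fun α => pd_eigenvector_mul_star (w := fun y => S.v j x ξ y ξ)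
    (p := fun y => momentum σ y ξ) vl ml hp0 (tl.eventually hn) (tl.eventually he) α
  have hY : ∀ α, _ := fun α => pd_eigenvector_mul_star (w := fun η => S.v j x ξ x η)
    (p := fun η => momentum σ x η) vr mr hp0 (tr.eventually hn) (tr.eventually he) α
  simp only [pd_momentum_right, pd_momentum_left hd'] at hX hY
  have hB : ∀ α, _ := fun α =>
    bracket_eq hnx hP (hX α).choose_spec (hY α).choose_spec
  have hC : ∀ α, _ := fun α =>
    bracket₃_eq hl hP (hX α).choose_spec (hY α).choose_spec
  have e1 : poisson (S.v j x ξ) (S.v j x ξ) x ξ = ∑ α, Complex.I / 2 *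
      (((len (momentum σ x ξ))⁻¹ : ℝ) : ℂ) ^ 3 * (tripleProd (momentum σ x ξ)
        (fun k => ∑ β, pd α (fun y => frame σ y k β) x * ξ β) (fun k => frame σ x k α) : ℂ) := by
    refine Finset.sum_congr rfl fun α _ => ?_
    rw [← hB α]
    simp only [pdx, pdxi, pd_star]
  have e2 : poisson₃ (S.v j x ξ) (linSymbol σ x ξ - ((S.h j x ξ : ℝ) : ℂ) •
      (1 : Matrix (Fin 2) (Fin 2) ℂ)) (S.v j x ξ) x ξ =
      -2 * len (momentum σ x ξ) * poisson (S.v j x ξ) (S.v j x ξ) x ξ := by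
    rw [(h x hx).linSymbol_eq, S.h_eq h j hx hξ, poisson, poisson₃, Finset.mul_sum]
    refine Finset.sum_congr rfl fun α _ => ?_
    simp only [pdx, pdxi, pd_star]
    exact hC α
  -- The quadratic form v*Bv is tr(B vv*), so it too depends on v only through the projection.
  have e3 : dotProduct (star (S.v j x ξ x ξ))
      ((subprincipal (linSymbol σ) A₀ x ξ).mulVec (S.v j x ξ x ξ)) =
      ∑ i, ∑ i', subprincipal (linSymbol σ) A₀ x ξ i i' *
        (S.v j x ξ x ξ i' * star (S.v j x ξ x ξ i)) := by
    simp only [dotProduct, Matrix.mulVec, Fin.sum_univ_two, Pi.star_apply]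
    ring
  rw [PositiveEigensystem.integrand, e2, e3, e1, S.h_eq h j hx hξ, ← Finset.mul_sum]
  simp only [hP, Matrix.trace_fin_two, Fin.sum_univ_two, Matrix.one_apply_eq, ne_eq, zero_ne_one,
    one_ne_zero, not_false_eq_true, Matrix.one_apply_ne]
  push_cast
  have hl' : (len (momentum σ x ξ) : ℂ) ≠ 0 := Complex.ofReal_ne_zero.2 hl
  generalize (∑ α, (tripleProd (momentum σ x ξ)
        (fun k => ∑ β, pd α (fun y => frame σ y k β) x * ξ β) (fun k => frame σ x k α) : ℂ)) = T
  generalize subprincipal (linSymbol σ) A₀ x ξ = B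
  field_simp
  norm_num
  ring

theorem subprincipal_linSymbol (a₀ : Coord 3 → Matrix (Fin 2) (Fin 2) ℂ) (x ξ : Coord 3)
    (i j : Fin 2) : subprincipal (linSymbol σ) (fun y _ => a₀ y) x ξ i j =
      a₀ x i j + Complex.I / 2 * ∑ α, pd α (fun y => σ y α i j) x := by
  rw [subprincipal]
  congr 2
  refine Finset.sum_congr rfl fun α _ => ?_
  have : ∀ y η, pdxi α (fun y η => linSymbol σ y η i j) y η = σ y α i j := by
    intro y η
    let L : Coord 3 →L[ℝ] ℂ := ∑ α,
      (EuclideanSpace.proj (𝕜 := ℝ) α : Coord 3 →L[ℝ] ℝ).smulRight (σ y α i j)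
    have hL : (fun η => linSymbol σ y η i j) = L := by
      funext η
      simp [L, linSymbol, Matrix.sum_apply]
    rw [pdxi, pd, hL, L.fderiv]
    simp [L]
  simp only [pdx, this]

theorem subprincipal_linSymbol_const (a₀ : Coord 3 → Matrix (Fin 2) (Fin 2) ℂ) (x ξ η : Coord 3) :
    subprincipal (linSymbol σ) (fun y _ => a₀ y) x ξ =
      subprincipal (linSymbol σ) (fun y _ => a₀ y) x η := by
  ext i j
  rw [subprincipal_linSymbol, subprincipal_linSymbol]

end Integrand

/-! ### Integrals of homogeneous functions of degree zero over the unit ball -/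

theorem len_ofLp (p : Coord 3) : len p = ‖p‖ := by
  rw [len, sqLen, EuclideanSpace.norm_eq]
  simp [Fin.sum_univ_three]

theorem setIntegral_ball_comp_isometry {E : Type*} [NormedAddCommGroup E] [NormedSpace ℝ E]
    (e : Coord 3 ≃ₗᵢ[ℝ] Coord 3) (f : Coord 3 → E) :
    ∫ p in Metric.ball 0 1, f (e p) = ∫ p in Metric.ball 0 1, f p := by
  have h := e.measurePreserving.setIntegral_preimage_emb
    e.toHomeomorph.measurableEmbedding f (Metric.ball 0 1)
  rwa [e.preimage_ball, map_zero] at h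

theorem abs_apply_le_norm (p : Coord 3) (k : Fin 3) : |p k| ≤ ‖p‖ := PiLp.norm_apply_le p k

theorem measureReal_unitBall : volume.real (Metric.ball (0 : Coord 3) 1) = 4 * Real.pi / 3 := by
  rw [Measure.real, EuclideanSpace.volume_ball_fin_three, ENNReal.toReal_mul,
    ENNReal.toReal_ofReal (by positivity)]
  simp
  ring

/-- The components `p_k / |p|` of the direction of `p`. -/
def dirFun (k : Fin 3) (p : Coord 3) : ℝ := ‖p‖⁻¹ * p k

theorem measurable_dirFun (k : Fin 3) : Measurable (dirFun k) := by
  unfold dirFun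
  fun_prop

theorem abs_dirFun_le (k : Fin 3) (p : Coord 3) : |dirFun k p| ≤ 1 := by
  rw [dirFun, abs_mul, abs_inv, abs_norm]
  exact (mul_le_mul_of_nonneg_left (abs_apply_le_norm p k) (by positivity)).trans
    inv_mul_le_one

theorem integrableOn_dirFun (k : Fin 3) : IntegrableOn (dirFun k) (Metric.ball 0 1) :=
  Measure.integrableOn_of_bounded (M := 1) measure_ball_lt_top.ne
    (measurable_dirFun k).aestronglyMeasurable (Eventually.of_forall fun p => abs_dirFun_le k p)

theorem integrableOn_dirFun_mul (j k : Fin 3) :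
    IntegrableOn (fun p => dirFun j p * dirFun k p) (Metric.ball 0 1) :=
  Measure.integrableOn_of_bounded (M := 1) measure_ball_lt_top.ne
    ((measurable_dirFun j).mul (measurable_dirFun k)).aestronglyMeasurable
    (Eventually.of_forall fun p => by
      rw [Real.norm_eq_abs, abs_mul]
      exact mul_le_one₀ (abs_dirFun_le j p) (abs_nonneg _) (abs_dirFun_le k p))

theorem integral_dirFun (k : Fin 3) : ∫ p in Metric.ball 0 1, dirFun k p = 0 := by
  have h := setIntegral_ball_comp_isometry (LinearIsometryEquiv.neg ℝ) (dirFun k)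
  have h1 : ∀ p : Coord 3, dirFun k (LinearIsometryEquiv.neg ℝ p) = -dirFun k p := fun p => by
    simp [dirFun]
  simp only [h1, integral_neg] at h
  linarith

/-- Reflecting the single coordinate j preserves the ball and reverses the sign of the integrand. -/
theorem integral_dirFun_mul_of_ne {j k : Fin 3} (hjk : j ≠ k) :
    ∫ p in Metric.ball 0 1, dirFun j p * dirFun k p = 0 := by
  let e : Coord 3 ≃ₗᵢ[ℝ] Coord 3 := LinearIsometryEquiv.piLpCongrRight 2 fun i =>
    if i = j then LinearIsometryEquiv.neg ℝ else LinearIsometryEquiv.refl ℝ ℝ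
  have h := setIntegral_ball_comp_isometry e (fun p => dirFun j p * dirFun k p)
  have h1 : ∀ p : Coord 3, dirFun j (e p) * dirFun k (e p) = -(dirFun j p * dirFun k p) :=
    fun p => by
      have a : (e p) j = -p j := by simp [e]
      have b : (e p) k = p k := by simp [e, hjk.symm]
      rw [dirFun, dirFun, a, b, e.norm_map, dirFun, dirFun]
      ring
  simp only [h1, integral_neg] at h
  linarith

theorem integral_dirFun_sq_eq (j k : Fin 3) :
    ∫ p in Metric.ball 0 1, dirFun j p * dirFun j p =
      ∫ p in Metric.ball 0 1, dirFun k p * dirFun k p := by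
  let e : Coord 3 ≃ₗᵢ[ℝ] Coord 3 := LinearIsometryEquiv.piLpCongrLeft 2 ℝ ℝ (Equiv.swap j k)
  have h := setIntegral_ball_comp_isometry e (fun p => dirFun k p * dirFun k p)
  rw [← h]
  refine integral_congr_ae (Eventually.of_forall fun p => ?_)
  have b : (e p) k = p j := by simp [e]
  simp only [dirFun, b, e.norm_map]

theorem ae_ne_zero_unitBall : ∀ᵐ p ∂volume.restrict (Metric.ball (0 : Coord 3) 1), p ≠ 0 :=
  ae_restrict_of_ae (Measure.ae_ne volume 0)

/-- Swapping coordinates makes the three integrals equal, and their integrands sum to 1 off the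
origin; each is a third of the volume 4π/3. -/
theorem integral_dirFun_sq (j : Fin 3) :
    ∫ p in Metric.ball 0 1, dirFun j p * dirFun j p = 4 * Real.pi / 9 := by
  have h : ∑ k, ∫ p in Metric.ball 0 1, dirFun k p * dirFun k p = 4 * Real.pi / 3 := by
    rw [← integral_finsetSum _ fun k _ => integrableOn_dirFun_mul k k, ← measureReal_unitBall]
    have : (fun p => ∑ k, dirFun k p * dirFun k p) =ᵐ[volume.restrict (Metric.ball (0 : Coord 3) 1)]
        fun _ => (1 : ℝ) := by
      filter_upwards [ae_ne_zero_unitBall] with p hp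
      have hn : ‖p‖ ≠ 0 := norm_ne_zero_iff.2 hp
      have hs : ‖p‖ ^ 2 = p 0 ^ 2 + p 1 ^ 2 + p 2 ^ 2 := by rw [← len_ofLp, len_sq, sqLen]
      simp only [dirFun, Fin.sum_univ_three]
      field_simp
      linarith
    rw [integral_congr_ae this]
    simp
  simp only [fun k => integral_dirFun_sq_eq k j] at h
  simp at h
  linarith

/-- A polynomial of degree at most two in the components of the direction `p / |p|`. -/
def angularFun (c₀ : ℂ) (c : Fin 3 → ℂ) (D : Fin 3 → Fin 3 → ℝ) (p : Coord 3) : ℂ :=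
  c₀ + ∑ k, c k * (dirFun k p : ℂ) + ∑ j, ∑ k, (D j k : ℂ) * ((dirFun j p * dirFun k p : ℝ) : ℂ)

theorem integrableOn_angularFun (c₀ : ℂ) (c : Fin 3 → ℂ) (D : Fin 3 → Fin 3 → ℝ) :
    IntegrableOn (angularFun c₀ c D) (Metric.ball 0 1) := by
  refine ((integrableOn_const measure_ball_lt_top.ne).add ?_).add ?_
  · exact integrable_finsetSum _ fun k _ => (integrableOn_dirFun k).ofReal.const_mul _
  · exact integrable_finsetSum _ fun j _ => integrable_finsetSum _ fun k _ =>
      (integrableOn_dirFun_mul j k).ofReal.const_mul _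

theorem integral_angularFun (c₀ : ℂ) (c : Fin 3 → ℂ) (D : Fin 3 → Fin 3 → ℝ) :
    ∫ p in Metric.ball 0 1, angularFun c₀ c D p =
      4 * Real.pi / 3 * c₀ + 4 * Real.pi / 9 * ((∑ j, D j j : ℝ) : ℂ) := by
  have i0 : IntegrableOn (fun _ : Coord 3 => c₀) (Metric.ball 0 1) :=
    integrableOn_const measure_ball_lt_top.ne
  have i1 : ∀ k, IntegrableOn (fun p => c k * (dirFun k p : ℂ)) (Metric.ball 0 1) :=
    fun k => (integrableOn_dirFun k).ofReal.const_mul _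
  have i2 : ∀ j k, IntegrableOn (fun p => (D j k : ℂ) * ((dirFun j p * dirFun k p : ℝ) : ℂ))
      (Metric.ball 0 1) := fun j k => (integrableOn_dirFun_mul j k).ofReal.const_mul _
  have i3 : IntegrableOn (fun p => ∑ k, c k * (dirFun k p : ℂ)) (Metric.ball 0 1) :=
    integrable_finsetSum _ fun k _ => i1 k
  have i4 : ∀ j, IntegrableOn (fun p => ∑ k, (D j k : ℂ) * ((dirFun j p * dirFun k p : ℝ) : ℂ))
      (Metric.ball 0 1) := fun j => integrable_finsetSum _ fun k _ => i2 j k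
  have i5 : IntegrableOn (fun p => ∑ j, ∑ k, (D j k : ℂ) * ((dirFun j p * dirFun k p : ℝ) : ℂ))
      (Metric.ball 0 1) := integrable_finsetSum _ fun j _ => i4 j
  have m2 : ∀ j k, ∫ p in Metric.ball 0 1, dirFun j p * dirFun k p =
      if j = k then 4 * Real.pi / 9 else 0 := fun j k => by
    split_ifs with h
    · rw [h, integral_dirFun_sq]
    · exact integral_dirFun_mul_of_ne h
  have i6 : IntegrableOn (fun p => c₀ + ∑ k, c k * (dirFun k p : ℂ)) (Metric.ball 0 1) := i0.add i3
  unfold angularFun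
  rw [integral_add i6 i5, integral_add i0 i3, integral_finsetSum _ fun k _ => i1 k,
    integral_finsetSum _ fun j _ => i4 j, setIntegral_const, measureReal_unitBall]
  simp only [integral_finsetSum _ fun k _ => i2 _ k, integral_const_mul, integral_complex_ofReal,
    integral_dirFun, m2]
  simp only [Fin.sum_univ_three]
  simp [Complex.real_smul]
  ring

/-! ### Change of variables from covectors to frame components -/

section Change

variable {σ : Coord 3 → Fin 3 → Matrix (Fin 2) (Fin 2) ℂ} {x : Coord 3}

/-- The linear map `ξ ↦ p` from covectors to their components in the frame. -/
def momentumMap (σ : Coord 3 → Fin 3 → Matrix (Fin 2) (Fin 2) ℂ) (x : Coord 3) :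
    Coord 3 →ₗ[ℝ] Coord 3 := Matrix.toEuclideanLin (frameMat σ x)

theorem momentumMap_apply (ξ : Coord 3) : (momentumMap σ x ξ).ofLp = momentum σ x ξ := rfl

theorem det_momentumMap : LinearMap.det (momentumMap σ x) = (frameMat σ x).det := by
  rw [momentumMap, Matrix.toEuclideanLin_eq_toLin_orthonormal, LinearMap.det_toLin]

theorem IsDiracAt.measurableEmbedding_momentumMap (h : IsDiracAt σ x) :
    MeasurableEmbedding (momentumMap σ x) := by
  refine (LinearMap.isClosedEmbedding_of_injective ?_).measurableEmbedding
  refine LinearMap.ker_eq_bot'.2 fun ξ hξ => ?_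
  by_contra h0
  exact h.momentum_ne_zero h0 (by rw [← momentumMap_apply, hξ]; rfl)

theorem IsDiracAt.map_momentumMap (h : IsDiracAt σ x) :
    Measure.map (momentumMap σ x) volume = ENNReal.ofReal (sqrtDet σ x) • volume := by
  rw [Measure.map_linearMap_addHaar_eq_smul_addHaar volume
    (by rw [det_momentumMap]; exact h.det_frameMat_ne_zero), det_momentumMap, h.sqrtDet_eq, abs_inv]

theorem IsDiracAt.setIntegral_comp_momentumMap (h : IsDiracAt σ x) (f : Coord 3 → ℂ)
    (s : Set (Coord 3)) :
    ∫ ξ in momentumMap σ x ⁻¹' s, f (momentumMap σ x ξ) = sqrtDet σ x * ∫ p in s, f p := by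
  rw [← h.measurableEmbedding_momentumMap.setIntegral_map, h.map_momentumMap,
    Measure.restrict_smul, integral_smul_measure,
    ENNReal.toReal_ofReal (show 0 ≤ sqrtDet σ x from Real.sqrt_nonneg _), Complex.real_smul]

theorem IsDiracAt.integrableOn_comp_momentumMap (h : IsDiracAt σ x) {f : Coord 3 → ℂ}
    {s : Set (Coord 3)} (hf : IntegrableOn f s) :
    IntegrableOn (fun ξ => f (momentumMap σ x ξ)) (momentumMap σ x ⁻¹' s) := by
  refine h.measurableEmbedding_momentumMap.integrableOn_map_iff.1 ?_
  rw [h.map_momentumMap, IntegrableOn, Measure.restrict_smul]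
  exact Integrable.smul_measure hf ENNReal.ofReal_ne_top

/-- The coefficients of the quadratic part of the integrand. -/
def quadCoeff (σ : Coord 3 → Fin 3 → Matrix (Fin 2) (Fin 2) ℂ) (x : Coord 3) (j m : Fin 3) : ℝ :=
  ∑ α, tripleProd (Pi.single j 1)
    (fun k => ∑ β, pd α (fun y => frame σ y k β) x * coframe σ x m β) (fun k => frame σ x k α)

/-- Expanding ξ_β = 𝐕_{mβ}p_m turns an expression mixing p and ξ into a quadratic form in p alone.
-/
theorem IsDiracAt.sum_tripleProd (h : IsDiracAt σ x) (ξ : Coord 3) :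
    ∑ α, tripleProd (momentum σ x ξ)
        (fun k => ∑ β, pd α (fun y => frame σ y k β) x * ξ β) (fun k => frame σ x k α) =
      ∑ j, ∑ m, quadCoeff σ x j m * (momentum σ x ξ j * momentum σ x ξ m) := by
  have h1 : ∀ α k, ∑ β, pd α (fun y => frame σ y k β) x * ξ β =
      ∑ m, (∑ β, pd α (fun y => frame σ y k β) x * coframe σ x m β) * momentum σ x ξ m := by
    intro α k
    simp only [← h.sum_coframe_mul_momentum ξ, Finset.mul_sum, Finset.sum_mul]
    rw [Finset.sum_comm]
    simp only [mul_assoc]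
  simp only [h1, quadCoeff]
  generalize hW : (fun α k m => ∑ β, pd α (fun y => frame σ y k β) x * coframe σ x m β) = W
  have hW' : ∀ α k m, ∑ β, pd α (fun y => frame σ y k β) x * coframe σ x m β = W α k m :=
    fun α k m => by rw [← hW]
  simp only [hW', tripleProd, Fin.sum_univ_three]
  simp
  ring

/-- Differentiated duality trades V_nᵛ∂_μ𝐕_{lν} for -𝐕_{lν}∂_μV_nᵛ; the minus sign is absorbed by
exchanging two indices of ε. -/
theorem trace_quadCoeff (hd : ∀ α i j, DifferentiableAt ℝ (fun y => σ y α i j) x)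
    (h : ∀ᶠ y in 𝓝 x, IsDiracAt σ y) : ∑ j, quadCoeff σ x j j = axialTorsion σ x := by
  generalize hW : (fun α k m => ∑ β, pd α (fun y => frame σ y k β) x * coframe σ x m β) = W
  have hW1 : ∀ α k m, ∑ β, pd α (fun y => frame σ y k β) x * coframe σ x m β = W α k m :=
    fun α k m => by rw [← hW]
  have hW2 : ∀ μ n l, ∑ ν, frame σ x n ν * pd μ (fun y => coframe σ y l ν) x = -W μ n l := by
    intro μ n l
    have h1 := sum_pd_coframe_mul_frame hd h l n μ
    rw [Finset.sum_add_distrib] at h1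
    rw [← hW1]
    simp only [mul_comm (frame σ x n _), mul_comm (pd μ (fun y => frame σ y n _) x)]
    linarith
  simp only [axialTorsion, sum_eps, mul_assoc, ← Finset.mul_sum, hW2, quadCoeff, hW1]
  simp only [tripleProd, Fin.sum_univ_three]
  simp
  ring

variable {U : Set (Coord 3)} {k : ℕ}

theorem PositiveEigensystem.region_eq (S : PositiveEigensystem U (linSymbol σ) k)
    (h : ∀ x ∈ U, IsDiracAt σ x) (j : Fin k) (hx : x ∈ U) :
    S.region j x = momentumMap σ x ⁻¹' (Metric.ball 0 1 \ {0}) := by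
  ext ξ
  have hz : momentumMap σ x ξ = 0 ↔ ξ = 0 := by
    refine ⟨fun h0 => ?_, fun h0 => by rw [h0, map_zero]⟩
    by_contra hξ
    exact (h x hx).momentum_ne_zero hξ (by rw [← momentumMap_apply, h0]; rfl)
  simp only [PositiveEigensystem.region, mem_ofPred_eq, mem_preimage, Set.mem_sdiff, Metric.mem_ball,
    dist_zero_right, mem_singleton_iff, hz, ← len_ofLp, momentumMap_apply]
  constructor
  · rintro ⟨h0, h1⟩
    rw [S.h_eq h j hx h0] at h1
    exact ⟨h1, h0⟩
  · rintro ⟨h1, h0⟩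
    rw [S.h_eq h j hx h0]
    exact ⟨h0, h1⟩

/-- The coefficients of the part of the integrand which is odd in `ξ`. -/
def oddCoeff (B : Matrix (Fin 2) (Fin 2) ℂ) : Fin 3 → ℂ :=
  -- The entries are ½ tr(B sᵏ).
  ![1 / 2 * (B 0 1 + B 1 0), Complex.I / 2 * (B 0 1 - B 1 0), 1 / 2 * (B 0 0 - B 1 1)]

theorem PositiveEigensystem.integrand_eq_angularFun (S : PositiveEigensystem U (linSymbol σ) k)
    (hU : IsOpen U) (hd : ∀ α i j, ContDiffOn ℝ ∞ (fun y => σ y α i j) U)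
    (h : ∀ x ∈ U, IsDiracAt σ x) (a₀ : Coord 3 → Matrix (Fin 2) (Fin 2) ℂ)
    (j : Fin k) {ξ : Coord 3} (hx : x ∈ U) (hξ : ξ ≠ 0) (η : Coord 3) :
    S.integrand (fun y _ => a₀ y) j x ξ = angularFun
      (1 / 2 * (subprincipal (linSymbol σ) (fun y _ => a₀ y) x η).trace)
      (oddCoeff (subprincipal (linSymbol σ) (fun y _ => a₀ y) x η))
      (fun i m => -(3 / 4) * quadCoeff σ x i m) (momentumMap σ x ξ) := by
  rw [S.integrand_eq hU hd h _ j hx hξ, ← Complex.ofReal_sum, (h x hx).sum_tripleProd,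
    subprincipal_linSymbol_const a₀ x ξ η]
  generalize subprincipal (linSymbol σ) (fun y _ => a₀ y) x η = B
  simp only [angularFun, dirFun, ← len_ofLp, momentumMap_apply]
  generalize momentum σ x ξ = p
  generalize quadCoeff σ x = D
  simp only [Fin.sum_univ_two, Fin.sum_univ_three, pauliMat_00, pauliMat_01, pauliMat_10,
    pauliMat_11, oddCoeff, Matrix.cons_val_zero, Matrix.cons_val_one, Matrix.cons_val]
  push_cast
  ring

end Change

/-- The constants are 4π/3 · ½ for the subprincipal trace and 4π/9 · (-¾) for the axial torsion,
with Jacobian factor √det g. The origin, excluded from the region, is a null set. -/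
theorem PositiveEigensystem.integral_integrand
    {σ : Coord 3 → Fin 3 → Matrix (Fin 2) (Fin 2) ℂ} {x : Coord 3} {U : Set (Coord 3)} {k : ℕ}
    (S : PositiveEigensystem U (linSymbol σ) k)
    (hU : IsOpen U) (hd : ∀ α i j, ContDiffOn ℝ ∞ (fun y => σ y α i j) U)
    (h : ∀ x ∈ U, IsDiracAt σ x) (a₀ : Coord 3 → Matrix (Fin 2) (Fin 2) ℂ)
    (j : Fin k) (hx : x ∈ U) (η : Coord 3) :
    IntegrableOn (S.integrand (fun y _ => a₀ y) j x) (S.region j x) ∧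
    ∫ ξ in S.region j x, S.integrand (fun y _ => a₀ y) j x ξ =
      sqrtDet σ x * (2 * Real.pi / 3 *
        (subprincipal (linSymbol σ) (fun y _ => a₀ y) x η).trace -
        Real.pi / 3 * (axialTorsion σ x : ℂ)) := by
  have hm : MeasurableSet (S.region j x) := by
    rw [S.region_eq h j hx]
    exact (h x hx).measurableEmbedding_momentumMap.measurable
      (Metric.isOpen_ball.measurableSet.diff (measurableSet_singleton 0))
  have hball : (Metric.ball (0 : Coord 3) 1 \ {0} : Set (Coord 3)) =ᵐ[volume] Metric.ball 0 1 :=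
    sdiff_null_ae_eq_self (measure_singleton 0)
  have hEq : EqOn (S.integrand (fun y _ => a₀ y) j x) (fun ξ => angularFun
      (1 / 2 * (subprincipal (linSymbol σ) (fun y _ => a₀ y) x η).trace)
      (oddCoeff (subprincipal (linSymbol σ) (fun y _ => a₀ y) x η))
      (fun i m => -(3 / 4) * quadCoeff σ x i m) (momentumMap σ x ξ)) (S.region j x) :=
    fun ξ hξ => S.integrand_eq_angularFun hU hd h a₀ j hx hξ.1 η
  constructor
  · refine IntegrableOn.congr_fun ?_ hEq.symm hm
    rw [S.region_eq h j hx]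
    exact (h x hx).integrableOn_comp_momentumMap
      ((integrableOn_angularFun _ _ _).mono_set sdiff_subset)
  · rw [setIntegral_congr_fun hm hEq, S.region_eq h j hx, (h x hx).setIntegral_comp_momentumMap,
      setIntegral_congr_set hball, integral_angularFun, ← Finset.mul_sum, trace_quadCoeff]
    · push_cast
      ring
    · exact fun α i j => ((hd α i j).contDiffAt (hU.mem_nhds hx)).differentiableAt (by simp)
    · exact (hU.eventually_mem hx).mono h

end SecondCoeff

end

theorem mainTheorem7 {M : Type*} [TopologicalSpace M] [ChartedSpace (SecondCoeff.Coord 3) M]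
    [IsManifold (𝓡 3) ∞ M] [T2Space M] [CompactSpace M] [ConnectedSpace M]
    (A : SecondCoeff.DiffOp 3 2 M) (hsym : A.IsSymmetric) (hell : A.IsElliptic)
    (htr : A.IsTraceFree)
    (φ : SecondCoeff.LocalCoords 3 M) (x : SecondCoeff.Coord 3) (hx : x ∈ φ.1.target) :
    (SecondCoeff.orientation (A.a₁ φ) x = 1 ∨ SecondCoeff.orientation (A.a₁ φ) x = -1) ∧
    Nonempty (SecondCoeff.PositiveEigensystem φ.1.target (A.principal φ) 1) ∧
    ∀ (k : ℕ) (S : SecondCoeff.PositiveEigensystem φ.1.target (A.principal φ) k),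
      (∀ j, MeasureTheory.IntegrableOn (S.integrand (A.degreeZero φ) j x) (S.region j x)) ∧
      ∀ η : SecondCoeff.Coord 3,
        S.b (A.degreeZero φ) x =
          (1 / (8 * (Real.pi : ℂ) ^ 2)) *
            ((SecondCoeff.orientation (A.a₁ φ) x *
                ((SecondCoeff.starTorsion (A.a₁ φ) x).trace : ℂ) -
              2 * (SecondCoeff.subprincipal (A.principal φ) (A.degreeZero φ) x η).trace) *
            (SecondCoeff.sqrtDet (A.a₁ φ) x : ℂ)) := by
  have hD : ∀ y ∈ φ.1.target, SecondCoeff.IsDiracAt (A.a₁ φ) y :=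
    fun y hy => SecondCoeff.DiffOp.isDiracAt hsym hell htr φ hy
  refine ⟨(hD x hx).orientation_eq_or,
    SecondCoeff.nonempty_positiveEigensystem φ.1.open_target (A.smooth₁ φ) hD, fun k S => ?_⟩
  refine ⟨fun j => (S.integral_integrand φ.1.open_target (A.smooth₁ φ) hD (A.a₀ φ) j hx 0).1,
    fun η => ?_⟩
  obtain rfl := S.card_eq_one hD hx
  have hI := (S.integral_integrand φ.1.open_target (A.smooth₁ φ) hD (A.a₀ φ) 0 hx η).2
  have hb : S.b (A.degreeZero φ) x = -((3 : ℕ) : ℂ) * (((2 * (Real.pi : ℂ)) ^ 3)⁻¹ *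
      ∫ ξ in S.region 0 x, S.integrand (fun y _ => A.a₀ φ y) 0 x ξ) := by
    rw [SecondCoeff.PositiveEigensystem.b, Fin.sum_univ_one]
    rfl
  have hc : ((SecondCoeff.sqrtDet (A.a₁ φ) x : ℂ) *
      ((SecondCoeff.frameMat (A.a₁ φ) x).det : ℂ)) ^ 2 = 1 := by
    exact_mod_cast (hD x hx).sqrtDet_mul_det_sq
  refine (hb.trans (congrArg (fun z => -((3 : ℕ) : ℂ) * (((2 * (Real.pi : ℂ)) ^ 3)⁻¹ * z)) hI)).trans ?_
  -- Both c and tr *T carry the factor √det g · det V = ±1, whose square is 1, so their product is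
  -- the axial torsion found in the integral.
  rw [(hD x hx).orientation_eq, (hD x hx).trace_starTorsion]
  change _ = 1 / (8 * (Real.pi : ℂ) ^ 2) * ((_ * _ - 2 * (SecondCoeff.subprincipal
    (SecondCoeff.linSymbol (A.a₁ φ)) (fun y _ => A.a₀ φ y) x η).trace) * _)
  have hpi : (Real.pi : ℂ) ≠ 0 := Complex.ofReal_ne_zero.2 Real.pi_ne_zero
  generalize (SecondCoeff.subprincipal
    (SecondCoeff.linSymbol (A.a₁ φ)) (fun y _ => A.a₀ φ y) x η).trace = B
  push_cast
  field_simp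
  linear_combination -8 * (SecondCoeff.sqrtDet (A.a₁ φ) x : ℂ) *
    (SecondCoeff.axialTorsion (A.a₁ φ) x : ℂ) * hc
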